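/- **Setting.** Let $A\in\mathbb R^{n\times n}$, $B\in\mathbb R^{n\times m}$, $C\in\mathbb R^{r\times n}$, $D\in\mathbb R^{r\times m}$, $G\in\mathbb R^{n\times n}$ with $D^TC=0$, $D^TD\succ0$, $GG^T\succ0$ and $(C,A)$ detectable. For $K\in\mathbb R^{m\times n}$ put $A_K=A-BK$, $C_K=C-DK$, and let $\mathcal F$ be the set of $K$ such that $A_K$ is Schur stable. For $K\in\mathcal F$ let $$J(K)=\|T\|_2^2=\frac1{2\pi}\int_{-\pi}^{\pi}\mathrm{Tr}\big(T(e^{j\omega})^HT(e^{j\omega})\big)\,d\omega,\qquad T(z)=C_K(zI-A_K)^{-1}G .$$ Let $S(K)=\begin{bmatrix}A_K\\ \mathbf 1^T-\mathbf 1^TA_K\end{bmatrix}\in\mathbb R^{(n+1)\times n}$. The problem is to minimize $J(K)$ subject to $S(K)\ge0$ entrywise. For $\eta\ge 0$, a gain $K\in\mathcal F$ is *$\eta$-stationary* if $S(K)\ge0$ and there is $Q\ge0$ (entrywise) in $\mathbb R^{(n+1)\times n}$ with $\mathrm{Tr}(Q^TS(K))=0$ and $\|\nabla J(K)-[-B^T\;\;B^T\mathbf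 1]\,Q\|\le\eta$ (Frobenius norm). It is *stationary* (a KKT point) if this holds with $\eta=0$. $K$ is *strictly feasible* if all entries of $S(K)$ are positive. **Algorithm (SIPM).** For $t>0$ and strictly feasible $K$ let $\Phi_t(K)=J(K)-\frac1t\sum_{i,j}\log S(K)_{ij}$ (and $\Phi_t=+\infty$ elsewhere). Fix $\mu>1$, $\delta>0$, $t^{(0)}>0$, Armijo parameters $c,\rho\in(0,1)$, a strictly feasible $K^{(0)}$, and inner tolerances $\varepsilon_h>0$. With respect to $\mathrm{vec}(K)$, let $g$ and $H=Q\Sigma Q^T$ be the gradient and Hessian of $\Phi_t$ at $K$, and let $H_\delta$ be $H$ with each eigenvalue below $\delta$ raised to $\delta$. A *Newton step* at $(K,t)$ replaces $K$ by $K-s\,\mathrm{mat}(\Delta)$ with $\Delta=H_\delta^{-1}g$, where $s$ is the first of $1,\rho,\rho^2,\dots$ for which $K-s\,\mathrm{mat}(\Delta)$ is strictly feasible and $\Phi_t(K-s\,\mathrm{mat}(\Delta))\le\Phi_t(K)-c\,s\,g^T\Delta$. Outer iteration $h$ starts from $K^{(h)}$ and repeats Newton steps at $t^{(h)}=\mu^ht^{(0)}$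 (at least one) until the gradient norm at the new inner iterate is below $\varepsilon_h$ or the inner iterate did not change; the result is $K^{(h+1)}$. The outer loop runs indefinitely (no outer stopping test). **Proposition.** 1. $J$ is $C^\infty$ at each point of $\mathcal F$. Every strictly feasible gain lies in $\mathcal F$, and $\Phi_t$ is $C^\infty$ there for every $t>0$. From every strictly feasible gain and for every $t>0$ a Newton step exists, and each Newton step leads to a strictly feasible gain. For fixed $t>0$, along any infinite sequence of Newton steps from a strictly feasible gain the gradient of $\Phi_t$ tends to $0$. In particular every inner loop stops after finitely many steps, and the algorithm generates an infinite sequence $(K^{(h)})$ for any tolerances $\varepsilon_h>0$. 2. If $\varepsilon_h\to\eta$ (for instance $\varepsilon_h=\eta>0$ for all $h$), then for every sequence $(K^{(h)})$ generated by the algorithm, all $K^{(h)}$ lie in one compact subset of $\mathcal F$, every accumulation point of $(K^{(h)})$ is $\eta$-stationary, and $J(K^{(h)})$ converges to some $J^*$. 3. If $\varepsilon_h\to0$, then the algorithm converges to stationary points: $(K^{(h)})$ has accumulation points, each of them is a stationary point of cost $J^*$, and the distance of $K^{(h)}$ to the set of stationary points of cost $J^*$ tends to $0$. If there is only one stationary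 point of cost $J^*$, the whole sequence $(K^{(h)})$ converges to it. -/

import Mathlib

open Filter Topology
open scoped Matrix ContDiff

noncomputable section

/-- The vectorised gain `vec K` (column-stacking), with the Euclidean norm, i.e. the Frobenius
norm of `K`. -/
abbrev GainVec (n m : ℕ) := EuclideanSpace ℝ (Fin n × Fin m)

/-- `vec`: column-stacking of a gain matrix. -/
def vecGain {n m : ℕ} (K : Matrix (Fin m) (Fin n) ℝ) : GainVec n m :=
  WithLp.toLp 2 (Matrix.vec K)

/-- `mat`: the inverse of `vec`. -/
def matGain {n m : ℕ} (x : GainVec n m) : Matrix (Fin m) (Fin n) ℝ :=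
  Matrix.of fun i j => x (j, i)

theorem matGain_vecGain {n m : ℕ} (K : Matrix (Fin m) (Fin n) ℝ) :
    matGain (vecGain K) = K := by
  ext i j; rfl

theorem vecGain_matGain {n m : ℕ} (x : GainVec n m) : vecGain (matGain x) = x := by
  ext p; rfl

/-- Schur stability: every complex eigenvalue lies in the open unit disc. -/
def IsSchur {n : ℕ} (M : Matrix (Fin n) (Fin n) ℝ) : Prop :=
  ∀ z ∈ spectrum ℂ (M.map (Complex.ofReal)), ‖z‖ < 1

/-- The row vector `𝟏ᵀ`. -/
def onesRow (n : ℕ) : Matrix Unit (Fin n) ℝ := Matrix.of fun _ _ => 1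

/-- The Hessian matrix of a function on a Euclidean space: `(p, q)` entry `∂_q ∂_p f`. -/
def hessianMatrix {ι : Type*} [Fintype ι] [DecidableEq ι] (f : EuclideanSpace ℝ ι → ℝ)
    (x : EuclideanSpace ℝ ι) : Matrix ι ι ℝ :=
  Matrix.of fun p q => (fderiv ℝ (gradient f) x (EuclideanSpace.single q 1)) p

/-- `H'` is obtained from `H` through a spectral decomposition `H = Q Σ Qᵀ` by raising every
eigenvalue below `δ` to `δ`. -/
def IsEigenvalueFloor {ι : Type*} [Fintype ι] [DecidableEq ι] (δ : ℝ)
    (H H' : Matrix ι ι ℝ) : Prop :=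
  ∃ Q ∈ Matrix.orthogonalGroup ι ℝ, ∃ σ : ι → ℝ,
    H = Q * Matrix.diagonal σ * Qᵀ ∧
    H' = Q * Matrix.diagonal (fun i => if δ ≤ σ i then σ i else δ) * Qᵀ

/-- The data of `x⁺ = A x + B u + G d`, `y = C x + D u`. -/
structure LTISystem (n m r : ℕ) where
  A : Matrix (Fin n) (Fin n) ℝ
  B : Matrix (Fin n) (Fin m) ℝ
  C : Matrix (Fin r) (Fin n) ℝ
  D : Matrix (Fin r) (Fin m) ℝ
  G : Matrix (Fin n) (Fin n) ℝ

/-- Parameters of the method: penalty growth `μ`, eigenvalue floor `δ`, initial penalty `t₀`,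
and the Armijo backtracking parameters (sufficient decrease `c`, contraction `ρ`). -/
structure SIPMParams where
  μ : ℝ
  δ : ℝ
  t₀ : ℝ
  c : ℝ
  ρ : ℝ

/-- Admissible parameters. -/
def SIPMParams.Valid (P : SIPMParams) : Prop :=
  1 < P.μ ∧ 0 < P.δ ∧ 0 < P.t₀ ∧ (0 < P.c ∧ P.c < 1) ∧ (0 < P.ρ ∧ P.ρ < 1)

namespace LTISystem

variable {n m r : ℕ} (S : LTISystem n m r)

/-- The pair `(C, A)` is detectable: some output injection makes `A - L C` Schur. -/
def Detectable : Prop :=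
  ∃ L : Matrix (Fin n) (Fin r) ℝ, IsSchur (S.A - L * S.C)

/-- `A_K = A - B K`. -/
def AK (K : Matrix (Fin m) (Fin n) ℝ) : Matrix (Fin n) (Fin n) ℝ := S.A - S.B * K

/-- `C_K = C - D K`. -/
def CK (K : Matrix (Fin m) (Fin n) ℝ) : Matrix (Fin r) (Fin n) ℝ := S.C - S.D * K

/-- The set `𝓕` of Schur stabilising gains. -/
def stabGains : Set (Matrix (Fin m) (Fin n) ℝ) := {K | IsSchur (S.AK K)}

/-- Closed-loop transfer function `T(z) = C_K (z I - A_K)⁻¹ G`. -/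
def transfer (K : Matrix (Fin m) (Fin n) ℝ) (z : ℂ) : Matrix (Fin r) (Fin n) ℂ :=
  (S.CK K).map Complex.ofReal *
    (z • (1 : Matrix (Fin n) (Fin n) ℂ) - (S.AK K).map Complex.ofReal)⁻¹ *
    S.G.map Complex.ofReal

/-- The `H₂` norm of the closed-loop transfer function. -/
def h2Norm (K : Matrix (Fin m) (Fin n) ℝ) : ℝ :=
  Real.sqrt ((1 / (2 * Real.pi)) * ∫ θ in (-Real.pi)..Real.pi,
    (Matrix.trace ((S.transfer K (Complex.exp (Complex.I * θ)))ᴴ *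
      S.transfer K (Complex.exp (Complex.I * θ)))).re)

/-- The objective `J(K)`, the squared `H₂` norm. -/
def J (K : Matrix (Fin m) (Fin n) ℝ) : ℝ := S.h2Norm K ^ 2

/-- The constraint matrix `[A_K ; 𝟏ᵀ - 𝟏ᵀ A_K]`. -/
def slack (K : Matrix (Fin m) (Fin n) ℝ) : Matrix (Fin n ⊕ Unit) (Fin n) ℝ :=
  Matrix.fromRows (S.AK K) (onesRow n - onesRow n * S.AK K)

/-- All constraints hold strictly, entry by entry. -/
def StrictlyFeasible (K : Matrix (Fin m) (Fin n) ℝ) : Prop := ∀ i j, 0 < S.slack K i j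

/-- The gradient `∇J(K)`, vectorised. -/
def gradJ (K : Matrix (Fin m) (Fin n) ℝ) : GainVec n m :=
  gradient (fun x => S.J (matGain x)) (vecGain K)

/-- The matrix `[-Bᵀ  Bᵀ𝟏] Q`. -/
def dualTerm (Q : Matrix (Fin n ⊕ Unit) (Fin n) ℝ) : Matrix (Fin m) (Fin n) ℝ :=
  Matrix.fromCols (-S.Bᵀ) (S.Bᵀ * (onesRow n)ᵀ) * Q

/-- `K` is a stationary point of `min J(K)` subject to `A_K ≥ 0`, `𝟏ᵀ A_K ≤ 𝟏ᵀ`: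
it is stabilising and satisfies the KKT conditions. -/
def IsStationary (K : Matrix (Fin m) (Fin n) ℝ) : Prop :=
  K ∈ S.stabGains ∧ ∃ Q : Matrix (Fin n ⊕ Unit) (Fin n) ℝ,
    matGain (S.gradJ K) - S.dualTerm Q = 0 ∧
    (∀ i j, 0 ≤ Q i j) ∧
    (∀ i j, 0 ≤ S.slack K i j) ∧
    Matrix.trace (Qᵀ * S.slack K) = 0

/-- The same, with residual at most `η` in the gradient equation. -/
def IsApproxStationary (η : ℝ) (K : Matrix (Fin m) (Fin n) ℝ) : Prop :=
  K ∈ S.stabGains ∧ ∃ Q : Matrix (Fin n ⊕ Unit) (Fin n) ℝ,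
    ‖vecGain (matGain (S.gradJ K) - S.dualTerm Q)‖ ≤ η ∧
    (∀ i j, 0 ≤ Q i j) ∧
    (∀ i j, 0 ≤ S.slack K i j) ∧
    Matrix.trace (Qᵀ * S.slack K) = 0

/-- The log-barrier objective. It is only ever evaluated at strictly feasible gains. -/
def JLBF (K : Matrix (Fin m) (Fin n) ℝ) (t : ℝ) : ℝ :=
  S.J K - (1 / t) * ∑ i, ∑ j, Real.log (S.slack K i j)

/-- The gradient of the log-barrier objective with respect to `vec K`. -/
def gradJLBF (K : Matrix (Fin m) (Fin n) ℝ) (t : ℝ) : GainVec n m :=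
  gradient (fun x => S.JLBF (matGain x) t) (vecGain K)

/-- The Hessian matrix of the log-barrier objective with respect to `vec K`. -/
def hessJLBF (K : Matrix (Fin m) (Fin n) ℝ) (t : ℝ) :
    Matrix (Fin n × Fin m) (Fin n × Fin m) ℝ :=
  hessianMatrix (fun x => S.JLBF (matGain x) t) (vecGain K)

/-- Armijo's condition for the step size `s` along `-ΔK`. The log-barrier objective is `+∞` off
the strictly feasible set, so the trial point has to be strictly feasible. -/
def ArmijoAccepts (P : SIPMParams) (t : ℝ) (K : Matrix (Fin m) (Fin n) ℝ)
    (ΔK : GainVec n m) (s : ℝ) : Prop :=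
  S.StrictlyFeasible (K - s • matGain ΔK) ∧
  S.JLBF (K - s • matGain ΔK) t ≤
    S.JLBF K t - P.c * s * inner ℝ (S.gradJLBF K t) ΔK

/-- One damped modified Newton step from `K` to `K'` at penalty parameter `t`: the step size is
the first of `1, ρ, ρ², …` accepted by Armijo's condition. -/
def NewtonStep (P : SIPMParams) (t : ℝ) (K K' : Matrix (Fin m) (Fin n) ℝ) : Prop :=
  ∃ (H : Matrix (Fin n × Fin m) (Fin n × Fin m) ℝ) (ΔK : GainVec n m) (i : ℕ),
    IsEigenvalueFloor P.δ (S.hessJLBF K t) H ∧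
    ΔK = WithLp.toLp 2 (H⁻¹ *ᵥ (S.gradJLBF K t).ofLp) ∧
    S.ArmijoAccepts P t K ΔK (P.ρ ^ i) ∧
    (∀ j < i, ¬ S.ArmijoAccepts P t K ΔK (P.ρ ^ j)) ∧
    K' = K - P.ρ ^ i • matGain ΔK

/-- The stopping test of the inner loop, for the current iterate `K` and the previous one. -/
def InnerStop (t ε : ℝ) (Kprev K : Matrix (Fin m) (Fin n) ℝ) : Prop :=
  ‖S.gradJLBF K t‖ < ε ∨ K = Kprev

/-- The inner repeat-until loop, started at `K` with penalty `t` and tolerance `ε`, stops after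
finitely many Newton steps (at least one) and hands back `K'`. -/
def InnerLoop (P : SIPMParams) (t ε : ℝ) (K K' : Matrix (Fin m) (Fin n) ℝ) : Prop :=
  ∃ (N : ℕ) (k : ℕ → Matrix (Fin m) (Fin n) ℝ),
    k 0 = K ∧ k (N + 1) = K' ∧
    (∀ i ≤ N, S.NewtonStep P t (k i) (k (i + 1))) ∧
    S.InnerStop t ε (k N) (k (N + 1)) ∧
    ∀ i < N, ¬ S.InnerStop t ε (k i) (k (i + 1))

/-- `K` is the sequence of outer iterates `K⁽⁰⁾, K⁽¹⁾, …` of the method started at `K₀`, with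
penalties `t⁽ʰ⁾ = μʰ t₀` and inner tolerances `ε h`, run without an outer stopping test. -/
def IsSIPMRun (P : SIPMParams) (ε : ℕ → ℝ) (K₀ : Matrix (Fin m) (Fin n) ℝ)
    (K : ℕ → Matrix (Fin m) (Fin n) ℝ) : Prop :=
  K 0 = K₀ ∧ ∀ h, S.InnerLoop P (P.μ ^ h * P.t₀) (ε h) (K h) (K (h + 1))

end LTISystem

end

/-! On the unit circle the Lyapunov equation makes the integrand of `J` affine in the real part of a
resolvent trace, and the mean value property evaluates the integral: `J K = tr(Gᵀ P G)` with `P` the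
observability Gramian (`J_eq_trace`). Vectorising the equation shows that `P` is rational in `K`, so
`J` is smooth on the stabilising gains.

Compactness comes from the partial sums of the impulse-response energy. They are polynomials in `K`
on the whole space, so the set where all of them are at most `c` is closed. The first one bounds
`K`, because `Dᵀ C = 0` and `Dᵀ D`, `G` are invertible. Detectability rules out an unstable mode
with finite energy, so the set consists of stabilising gains (`isCompact_energySublevel`,
`energySublevel_subset_stabGains`). Strictly feasible gains are stabilising by a column-sum
estimate, and their slacks lie in `(0, 1]`. Hence the barrier term is nonnegative, dominates nothing
but adds to `J`, and decreases as `t` grows.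

For fixed `t`, sublevel sets of the barrier objective are compactly contained in the strictly
feasible set. The floored Hessian yields gradient-related directions there, so Armijo backtracking
forces the gradient to zero (`tendsto_norm_gradient_of_armijo`) and inner loops stop.

For the outer loop, the barrier gradient is exactly the KKT residual for the multipliers `1 / (t
S_ij)`, whose products with the slacks equal `1 / t`. Since the constraints are affine, pairing with
the direction towards the strictly feasible `K₀` bounds the multipliers uniformly
(`exists_dual_bound`). Limits of gains and multipliers then satisfy the approximate KKT conditions.
The same bound keeps each slack above a constant over `t`, so the barrier term is `O(log t / t)`;
the monotone barrier values therefore make `J` converge. -/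

noncomputable section

/-! ### Schur stability and the discrete Lyapunov equation. -/

section Schur

variable {n : ℕ}

theorem Matrix.mem_spectrum_iff_exists_mulVec {ι : Type*} [Fintype ι] [DecidableEq ι]
    (M : Matrix ι ι ℂ) (z : ℂ) : z ∈ spectrum ℂ M ↔ ∃ v : ι → ℂ, v ≠ 0 ∧ M *ᵥ v = z • v := by
  rw [← Matrix.spectrum_toLin', ← Module.End.hasEigenvalue_iff_mem_spectrum]
  constructor
  · intro h
    obtain ⟨v, hv⟩ := h.exists_hasEigenvector
    exact ⟨v, hv.2, by simpa using hv.apply_eq_smul⟩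
  · rintro ⟨v, hv, h⟩
    exact Module.End.hasEigenvalue_of_hasEigenvector (x := v)
      ⟨Module.End.mem_eigenspace_iff.2 (by simpa using h), hv⟩

theorem Matrix.pow_mulVec_of_mulVec_eq_smul {ι : Type*} [Fintype ι] [DecidableEq ι]
    {M : Matrix ι ι ℂ} {z : ℂ} {v : ι → ℂ} (h : M *ᵥ v = z • v) (k : ℕ) :
    (M ^ k) *ᵥ v = z ^ k • v := by
  induction k with
  | zero => simp
  | succ k ih => rw [pow_succ, ← Matrix.mulVec_mulVec, h, Matrix.mulVec_smul, ih,
      smul_smul, pow_succ']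

theorem Matrix.map_ofReal_pow (M : Matrix (Fin n) (Fin n) ℝ) (k : ℕ) :
    (M ^ k).map Complex.ofReal = M.map Complex.ofReal ^ k :=
  map_pow (Complex.ofRealHom.mapMatrix (m := Fin n)) M k

section Norm

attribute [local instance] Matrix.linftyOpNormedRing Matrix.linftyOpNormedAlgebra

/-- Gelfand's formula: for `q` strictly between the spectral radius and `1`, eventually `‖A ^ k‖ ≤ q
^ k`. -/
theorem IsSchur.tendsto_pow_complex {M : Matrix (Fin n) (Fin n) ℝ} (h : IsSchur M) :
    Tendsto (fun k : ℕ => M.map Complex.ofReal ^ k) atTop (𝓝 0) := by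
  set A := M.map Complex.ofReal with hA
  rcases Nat.eq_zero_or_pos n with rfl | hn
  · exact tendsto_const_nhds.congr fun k => Subsingleton.elim _ _
  have : Nonempty (Fin n) := ⟨⟨0, hn⟩⟩
  have hr : spectralRadius ℂ A < 1 := by
    obtain ⟨z, hz, hz'⟩ := spectrum.exists_nnnorm_eq_spectralRadius A
    rw [← hz']
    exact_mod_cast h z hz
  obtain ⟨q, hq, hq1⟩ := exists_between hr
  have hev := (spectrum.pow_nnnorm_pow_one_div_tendsto_nhds_spectralRadius A).eventually_lt_const hq
  have hqt : Tendsto (fun k : ℕ => q ^ k) atTop (𝓝 0) :=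
    ENNReal.tendsto_pow_atTop_nhds_zero_of_lt_one hq1
  have h1 : Tendsto (fun k : ℕ => (‖A ^ k‖₊ : ENNReal)) atTop (𝓝 0) := by
    refine tendsto_of_tendsto_of_tendsto_of_le_of_le' tendsto_const_nhds hqt
      (Eventually.of_forall fun _ => zero_le) ?_
    filter_upwards [hev, eventually_gt_atTop 0] with k hk hk0
    have := ENNReal.rpow_le_rpow hk.le (Nat.cast_nonneg (α := ℝ) k)
    rw [← ENNReal.rpow_mul, one_div, inv_mul_cancel₀ (by positivity), ENNReal.rpow_one,
      ENNReal.rpow_natCast] at this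
    exact this
  refine tendsto_zero_iff_norm_tendsto_zero.2 ?_
  have h2 := (ENNReal.tendsto_coe (f := atTop) (m := fun k : ℕ => ‖A ^ k‖₊)
    (a := 0)).1 (by simpa using h1)
  simpa only [coe_nnnorm, NNReal.coe_zero] using NNReal.tendsto_coe.2 h2

/-- Eigenvalues of `M ^ N` include the `N`-th powers of those of `M`. As the criterion involves a
single power, it is an open condition on `M`. -/
theorem IsSchur.of_norm_pow_lt {M : Matrix (Fin n) (Fin n) ℝ} {N : ℕ}
    (h : ‖M.map Complex.ofReal ^ N‖ < 1) : IsSchur M := by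
  intro z hz
  rcases Nat.eq_zero_or_pos n with rfl | hn
  · obtain ⟨v, hv, -⟩ := (Matrix.mem_spectrum_iff_exists_mulVec _ _).1 hz
    exact absurd (Subsingleton.elim _ _) hv
  have : Nonempty (Fin n) := ⟨⟨0, hn⟩⟩
  by_contra! hz1
  have := spectrum.norm_le_norm_of_mem (spectrum.pow_mem_pow _ N hz)
  rw [norm_pow] at this
  linarith [one_le_pow₀ hz1 (n := N)]

theorem isOpen_isSchur : IsOpen {M : Matrix (Fin n) (Fin n) ℝ | IsSchur M} := by
  rw [isOpen_iff_mem_nhds]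
  intro M hM
  have h0 := (tendsto_zero_iff_norm_tendsto_zero.1 (IsSchur.tendsto_pow_complex hM))
  obtain ⟨N, hN⟩ := (h0.eventually_lt_const one_pos).exists
  have hc : Continuous fun M : Matrix (Fin n) (Fin n) ℝ => ‖M.map Complex.ofReal ^ N‖ :=
    ((continuous_id.matrix_map Complex.continuous_ofReal).pow N).norm
  filter_upwards [hc.continuousAt.eventually_lt_const hN] with M' hM'
  exact IsSchur.of_norm_pow_lt hM'

end Norm

theorem IsSchur.tendsto_pow {M : Matrix (Fin n) (Fin n) ℝ} (h : IsSchur M) :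
    Tendsto (fun k : ℕ => M ^ k) atTop (𝓝 0) := by
  have hc : Continuous fun X : Matrix (Fin n) (Fin n) ℂ => X.map Complex.re :=
    continuous_id.matrix_map Complex.continuous_re
  have := (hc.tendsto 0).comp h.tendsto_pow_complex
  convert! this using 1
  · ext1 k
    rw [Function.comp_apply, ← Matrix.map_ofReal_pow]
    ext i j; simp

/-- A matrix with nonnegative entries and column sums below one is Schur stable. -/
theorem isSchur_of_colSum_lt_one {M : Matrix (Fin n) (Fin n) ℝ} (h0 : ∀ i j, 0 ≤ M i j)
    (h1 : ∀ j, ∑ i, M i j < 1) : IsSchur M := by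
  intro z hz
  obtain ⟨v, hv, hMv⟩ := (Matrix.mem_spectrum_iff_exists_mulVec _ _).1 hz
  obtain ⟨j₀, hj₀⟩ := Function.ne_iff.1 hv
  have hpos : 0 < ∑ j, ‖v j‖ :=
    Finset.sum_pos' (fun _ _ => norm_nonneg _) ⟨j₀, Finset.mem_univ _, norm_pos_iff.2 hj₀⟩
  -- Column sums control the operator in the `ℓ¹` norm; strictness comes from a nonzero coordinate
  -- of `v`.
  have hle : ‖z‖ * ∑ j, ‖v j‖ < ∑ j, ‖v j‖ := by
    calc ‖z‖ * ∑ j, ‖v j‖ = ∑ i, ‖∑ j, (M i j : ℂ) * v j‖ := by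
          rw [Finset.mul_sum]
          refine Finset.sum_congr rfl fun i _ => ?_
          have := congrFun hMv i
          simp only [Matrix.mulVec, dotProduct, Matrix.map_apply, Pi.smul_apply, smul_eq_mul] at this
          rw [this, norm_mul]
      _ ≤ ∑ i, ∑ j, M i j * ‖v j‖ := by
          refine Finset.sum_le_sum fun i _ => (norm_sum_le _ _).trans_eq ?_
          refine Finset.sum_congr rfl fun j _ => ?_
          rw [norm_mul, Complex.norm_real, Real.norm_of_nonneg (h0 i j)]
      _ = ∑ j, (∑ i, M i j) * ‖v j‖ := by
          rw [Finset.sum_comm]; simp_rw [Finset.sum_mul]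
      _ < ∑ j, ‖v j‖ := by
          refine Finset.sum_lt_sum (fun j _ => ?_) ⟨j₀, Finset.mem_univ _, ?_⟩
          · exact mul_le_of_le_one_left (norm_nonneg _) (h1 j).le
          · exact mul_lt_of_lt_one_left (norm_pos_iff.2 hj₀) (h1 j₀)
  by_contra! hz1
  nlinarith

/-- The matrix of `X ↦ X - Mᵀ X M` with respect to column-stacking. -/
def lyapMatrix (M : Matrix (Fin n) (Fin n) ℝ) : Matrix (Fin n × Fin n) (Fin n × Fin n) ℝ :=
  1 - Matrix.kroneckerMap (· * ·) Mᵀ Mᵀ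

theorem lyapMatrix_mulVec_vec (M X : Matrix (Fin n) (Fin n) ℝ) :
    lyapMatrix M *ᵥ X.vec = (X - Mᵀ * X * M).vec := by
  rw [lyapMatrix, Matrix.sub_mulVec, Matrix.one_mulVec]
  rw [Matrix.kronecker_mulVec_vec, Matrix.transpose_transpose, Matrix.vec_sub]

/-- Used twice: with `Q = 0` for uniqueness, and with `Q = C_Kᵀ C_K` to recognise the sum as
impulse-response energy. -/
theorem lyap_iterate {M P Q : Matrix (Fin n) (Fin n) ℝ} (h : P = Mᵀ * P * M + Q) (N : ℕ) :
    P = ∑ k ∈ Finset.range N, (M ^ k)ᵀ * Q * M ^ k + (M ^ N)ᵀ * P * M ^ N := by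
  induction N with
  | zero => simp
  | succ N ih =>
    conv_lhs => rw [ih]
    rw [Finset.sum_range_succ, add_assoc, add_right_inj]
    conv_lhs => rw [h]
    rw [pow_succ', Matrix.transpose_mul]
    noncomm_ring

theorem IsSchur.tendsto_conj_pow {M : Matrix (Fin n) (Fin n) ℝ} (hM : IsSchur M)
    (P : Matrix (Fin n) (Fin n) ℝ) :
    Tendsto (fun k : ℕ => (M ^ k)ᵀ * P * M ^ k) atTop (𝓝 0) := by
  have hc : Continuous fun X : Matrix (Fin n) (Fin n) ℝ => Xᵀ * P * X := by fun_prop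
  have := (hc.tendsto 0).comp hM.tendsto_pow
  rw [Matrix.mul_zero] at this
  exact this

theorem IsSchur.lyap_injective {M : Matrix (Fin n) (Fin n) ℝ} (hM : IsSchur M)
    {P : Matrix (Fin n) (Fin n) ℝ} (h : P = Mᵀ * P * M) : P = 0 := by
  have h1 : ∀ N : ℕ, (M ^ N)ᵀ * P * M ^ N = P := fun N => by
    have := lyap_iterate (Q := 0) (by simpa using h) N
    simpa using this.symm
  have h2 := hM.tendsto_conj_pow P
  simp_rw [h1] at h2
  exact tendsto_nhds_unique tendsto_const_nhds h2

theorem IsSchur.det_lyapMatrix_ne_zero {M : Matrix (Fin n) (Fin n) ℝ} (hM : IsSchur M) :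
    (lyapMatrix M).det ≠ 0 := by
  intro h
  obtain ⟨v, hv, h0⟩ := Matrix.exists_mulVec_eq_zero_iff.2 h
  apply hv
  set X : Matrix (Fin n) (Fin n) ℝ := Matrix.of fun i j => v (j, i) with hX
  have hXv : X.vec = v := by ext p; rfl
  rw [← hXv, lyapMatrix_mulVec_vec, Matrix.vec_eq_zero_iff, sub_eq_zero] at h0
  rw [← hXv, hM.lyap_injective h0, Matrix.vec_zero]

/-- The solution `P` of `P = Mᵀ P M + Q`. -/
def lyapSol (M Q : Matrix (Fin n) (Fin n) ℝ) : Matrix (Fin n) (Fin n) ℝ :=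
  Matrix.of fun i j => ((lyapMatrix M)⁻¹ *ᵥ Q.vec) (j, i)

theorem IsSchur.lyapSol_eq {M : Matrix (Fin n) (Fin n) ℝ} (hM : IsSchur M)
    (Q : Matrix (Fin n) (Fin n) ℝ) : lyapSol M Q = Mᵀ * lyapSol M Q * M + Q := by
  have hv : (lyapSol M Q).vec = (lyapMatrix M)⁻¹ *ᵥ Q.vec := by ext p; rfl
  have h1 := lyapMatrix_mulVec_vec M (lyapSol M Q)
  rw [hv, Matrix.mulVec_mulVec, Matrix.mul_nonsing_inv _ (isUnit_iff_ne_zero.2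
    hM.det_lyapMatrix_ne_zero), Matrix.one_mulVec, Matrix.vec_inj] at h1
  exact (sub_eq_iff_eq_add'.1 h1.symm)

theorem IsSchur.lyapSol_transpose {M : Matrix (Fin n) (Fin n) ℝ} (hM : IsSchur M)
    {Q : Matrix (Fin n) (Fin n) ℝ} (hQ : Qᵀ = Q) : (lyapSol M Q)ᵀ = lyapSol M Q := by
  rw [← sub_eq_zero]
  apply hM.lyap_injective
  have h1 := hM.lyapSol_eq Q
  have h2 := congrArg Matrix.transpose h1
  simp only [Matrix.transpose_add, Matrix.transpose_mul, Matrix.transpose_transpose, hQ] at h2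
  calc (lyapSol M Q)ᵀ - lyapSol M Q
      = (Mᵀ * ((lyapSol M Q)ᵀ * M) + Q) - (Mᵀ * lyapSol M Q * M + Q) := by rw [← h1, ← h2]
    _ = Mᵀ * ((lyapSol M Q)ᵀ - lyapSol M Q) * M := by noncomm_ring

end Schur

/-! ### Smoothness of matrix operations, entry by entry. -/

section Entrywise

variable {𝕜 E : Type*} [NontriviallyNormedField 𝕜] [NormedAddCommGroup E] [NormedSpace 𝕜 E]
  {k : WithTop ℕ∞} {x : E}

theorem contDiffAt_matrix_mul_apply {l m n : Type*} [Fintype m] {A : E → Matrix l m 𝕜}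
    {B : E → Matrix m n 𝕜} (hA : ∀ i j, ContDiffAt 𝕜 k (fun y => A y i j) x)
    (hB : ∀ i j, ContDiffAt 𝕜 k (fun y => B y i j) x) (i : l) (j : n) :
    ContDiffAt 𝕜 k (fun y => (A y * B y) i j) x := by
  simp only [Matrix.mul_apply]
  exact ContDiffAt.sum fun a _ => (hA i a).mul (hB a j)

theorem contDiffAt_const_matrix_mul_apply {l m n : Type*} [Fintype m] (A : Matrix l m 𝕜)
    {B : E → Matrix m n 𝕜} (hB : ∀ i j, ContDiffAt 𝕜 k (fun y => B y i j) x) (i : l) (j : n) :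
    ContDiffAt 𝕜 k (fun y => (A * B y) i j) x :=
  contDiffAt_matrix_mul_apply (A := fun _ => A) (fun _ _ => contDiffAt_const) hB i j

theorem contDiffAt_matrix_mul_const_apply {l m n : Type*} [Fintype m] {A : E → Matrix l m 𝕜}
    (B : Matrix m n 𝕜) (hA : ∀ i j, ContDiffAt 𝕜 k (fun y => A y i j) x) (i : l) (j : n) :
    ContDiffAt 𝕜 k (fun y => (A y * B) i j) x :=
  contDiffAt_matrix_mul_apply (B := fun _ => B) hA (fun _ _ => contDiffAt_const) i j

theorem contDiffAt_matrix_det {n : Type*} [Fintype n] [DecidableEq n] {A : E → Matrix n n 𝕜}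
    (hA : ∀ i j, ContDiffAt 𝕜 k (fun y => A y i j) x) :
    ContDiffAt 𝕜 k (fun y => (A y).det) x := by
  simp only [Matrix.det_apply]
  refine ContDiffAt.sum fun σ _ => ?_
  simp only [Units.smul_def, zsmul_eq_mul]
  exact contDiffAt_const.mul (contDiffAt_prod fun i _ => hA _ _)

theorem contDiffAt_matrix_inv_apply {n : Type*} [Fintype n] [DecidableEq n] {A : E → Matrix n n 𝕜}
    (hA : ∀ i j, ContDiffAt 𝕜 k (fun y => A y i j) x) (h0 : (A x).det ≠ 0) (i j : n) :
    ContDiffAt 𝕜 k (fun y => (A y)⁻¹ i j) x := by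
  simp only [Matrix.inv_def, Matrix.smul_apply, Ring.inverse_eq_inv', smul_eq_mul,
    Matrix.adjugate_apply]
  refine ((contDiffAt_matrix_det hA).inv h0).mul (contDiffAt_matrix_det fun a b => ?_)
  by_cases hab : a = j
  · simp only [hab, Matrix.updateRow_self]; exact contDiffAt_const
  · simp only [Matrix.updateRow_ne hab]; exact hA a b

end Entrywise

/-! ### Averaging the resolvent over the unit circle. -/

section MeanValue

variable {n : ℕ}

theorem IsSchur.det_one_sub_smul_ne_zero {M : Matrix (Fin n) (Fin n) ℝ} (hM : IsSchur M) {w : ℂ}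
    (hw : ‖w‖ ≤ 1) : (1 - w • M.map Complex.ofReal).det ≠ 0 := by
  intro h
  obtain ⟨v, hv, h0⟩ := Matrix.exists_mulVec_eq_zero_iff.2 h
  rw [Matrix.sub_mulVec, Matrix.one_mulVec, Matrix.smul_mulVec, sub_eq_zero] at h0
  have hw0 : w ≠ 0 := by rintro rfl; exact hv (by simpa using h0)
  have h1 := hM w⁻¹ ((Matrix.mem_spectrum_iff_exists_mulVec _ _).2
    ⟨v, hv, by conv_rhs => rw [h0, smul_smul, inv_mul_cancel₀ hw0, one_smul]⟩)
  rw [norm_inv] at h1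
  have h2 := (one_le_inv₀ (norm_pos_iff.2 hw0)).2 hw
  linarith

theorem IsSchur.contDiffAt_trace_resolvent {M : Matrix (Fin n) (Fin n) ℝ} (hM : IsSchur M)
    (N : Matrix (Fin n) (Fin n) ℂ) {w : ℂ} (hw : ‖w‖ ≤ 1) :
    ContDiffAt ℂ 1 (fun w : ℂ => (N * (1 - w • M.map Complex.ofReal)⁻¹).trace) w := by
  simp only [Matrix.trace, Matrix.diag_apply]
  refine ContDiffAt.sum fun i _ => contDiffAt_const_matrix_mul_apply N
    (B := fun w : ℂ => (1 - w • M.map Complex.ofReal)⁻¹) (contDiffAt_matrix_inv_apply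
    (A := fun w : ℂ => 1 - w • M.map Complex.ofReal) (fun i j => ?_)
    (hM.det_one_sub_smul_ne_zero hw)) i i
  simp only [Matrix.sub_apply, Matrix.smul_apply, smul_eq_mul]
  fun_prop

theorem IsSchur.continuous_trace_resolvent {M : Matrix (Fin n) (Fin n) ℝ} (hM : IsSchur M)
    (N : Matrix (Fin n) (Fin n) ℂ) : Continuous fun θ : ℝ =>
      (N * (1 - Complex.exp (-(Complex.I * θ)) • M.map Complex.ofReal)⁻¹).trace := by
  rw [continuous_iff_continuousAt]
  intro θ
  have hn : ‖Complex.exp (-(Complex.I * θ))‖ ≤ 1 := by simp [Complex.norm_exp]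
  have h1 := (hM.contDiffAt_trace_resolvent N hn).continuousAt
  have h2 : ContinuousAt (fun θ : ℝ => Complex.exp (-(Complex.I * θ))) θ := by fun_prop
  exact ContinuousAt.comp (f := fun θ : ℝ => Complex.exp (-(Complex.I * θ))) h1 h2

/-- The resolvent trace is holomorphic on a neighbourhood of each point of the closed disc, so its
circle average is its value `tr N` at `w = 0`. -/
theorem IsSchur.integral_trace_resolvent {M : Matrix (Fin n) (Fin n) ℝ} (hM : IsSchur M)
    (N : Matrix (Fin n) (Fin n) ℂ) :
    ∫ θ in (-Real.pi)..Real.pi,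
      (N * (1 - Complex.exp (-(Complex.I * θ)) • M.map Complex.ofReal)⁻¹).trace =
      2 * Real.pi * N.trace := by
  set φ : ℂ → ℂ := fun w => (N * (1 - w • M.map Complex.ofReal)⁻¹).trace with hφ
  have hd : DifferentiableOn ℂ φ (Metric.closedBall 0 1) := fun w hw =>
    ((hM.contDiffAt_trace_resolvent N (by simpa using hw)).differentiableAt
      one_ne_zero).differentiableWithinAt
  have hcl : DiffContOnCl ℂ φ (Metric.ball 0 |1|) := by
    rw [abs_one]; exact hd.diffContOnCl_ball subset_rfl
  have hmv := hcl.circleAverage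
  rw [Real.circleAverage_def] at hmv
  have h0 : φ 0 = N.trace := by simp [hφ]
  -- Reflect `θ ↦ -θ`, then shift the period to `[0, 2π]`.
  have h1 : ∫ θ in (-Real.pi)..Real.pi, φ (Complex.exp (-(Complex.I * θ))) =
      ∫ θ in (0 : ℝ)..2 * Real.pi, φ (circleMap 0 1 θ) := by
    have hcm : ∀ θ : ℝ, φ (Complex.exp (-(Complex.I * θ))) = φ (circleMap 0 1 (-θ)) := by
      intro θ; congr 1; simp [circleMap, mul_comm]
    simp_rw [hcm]
    rw [intervalIntegral.integral_comp_neg (fun θ => φ (circleMap 0 1 θ)), neg_neg]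
    have hper : Function.Periodic (fun θ => φ (circleMap 0 1 θ)) (2 * Real.pi) := fun θ => by
      simp only [periodic_circleMap 0 1 θ]
    have := hper.intervalIntegral_add_eq (-Real.pi) 0
    rw [zero_add] at this
    rw [← this]; congr 1; ring
  rw [show (∫ θ in (-Real.pi)..Real.pi, (N * (1 - Complex.exp (-(Complex.I * θ)) •
    M.map Complex.ofReal)⁻¹).trace) = ∫ θ in (-Real.pi)..Real.pi,
    φ (Complex.exp (-(Complex.I * θ))) from rfl, h1]
  rw [h0] at hmv
  rw [← hmv, Complex.real_smul, ← mul_assoc]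
  push_cast
  rw [mul_inv_cancel₀ (by simp [Real.pi_ne_zero]), one_mul]

/-- For `W = (1 - wA)⁻¹`, the Lyapunov equation turns the quadratic `Wᴴ Cᴴ C W` into `Wᴴ P + P W -
P`, which is linear in `W` and `Wᴴ`. Only then does the mean value property apply. -/
theorem trace_conjTranspose_mul_self_re {p q : Type*} [Fintype p] [Fintype q] [DecidableEq p]
    {A P W G : Matrix p p ℂ} {C : Matrix q p ℂ} {w : ℂ} (hP : Pᴴ = P)
    (hL : P = Aᴴ * P * A + Cᴴ * C) (hW : W = 1 + w • (A * W)) (hw : star w * w = 1) :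
    (((C * W * G)ᴴ * (C * W * G)).trace).re =
      2 * ((G * Gᴴ * P * W).trace).re - ((G * Gᴴ * P).trace).re := by
  have h1 : Wᴴ * (Cᴴ * C) * W = Wᴴ * P + P * W - P := by
    -- Here `W - 1 = w A W`, and the factor `w` cancels because it has modulus one.
    have h2 : Wᴴ * (Aᴴ * P * A) * W = (W - 1)ᴴ * P * (W - 1) := by
      have : W - 1 = w • (A * W) := sub_eq_iff_eq_add'.2 hW
      rw [this, Matrix.conjTranspose_smul, Matrix.smul_mul, Matrix.smul_mul, Matrix.mul_smul,
        smul_smul, hw, one_smul, Matrix.conjTranspose_mul]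
      simp only [Matrix.mul_assoc]
    have h3 : Cᴴ * C = P - Aᴴ * P * A := (sub_eq_iff_eq_add'.2 hL).symm
    rw [h3, Matrix.mul_sub, Matrix.sub_mul, h2, Matrix.conjTranspose_sub,
      Matrix.conjTranspose_one]
    noncomm_ring
  have h4 : (C * W * G)ᴴ * (C * W * G) = Gᴴ * (Wᴴ * (Cᴴ * C) * W) * G := by
    simp only [Matrix.conjTranspose_mul, Matrix.mul_assoc]
  have h5 : (Gᴴ * (Wᴴ * P) * G).trace = star ((G * Gᴴ * P * W).trace) := by
    rw [← Matrix.trace_conjTranspose]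
    simp only [Matrix.conjTranspose_mul, Matrix.conjTranspose_conjTranspose, hP]
    rw [Matrix.trace_mul_comm]
    rw [Matrix.trace_mul_comm (Wᴴ)]
    rw [← Matrix.mul_assoc, Matrix.trace_mul_comm]
    simp only [Matrix.mul_assoc]
    rw [Matrix.trace_mul_comm]
    simp only [Matrix.mul_assoc]
  have h6 : (Gᴴ * (P * W) * G).trace = (G * Gᴴ * P * W).trace := by
    rw [Matrix.trace_mul_comm]; simp only [Matrix.mul_assoc]
  have h7 : (Gᴴ * P * G).trace = (G * Gᴴ * P).trace := by
    rw [Matrix.trace_mul_comm]; simp only [Matrix.mul_assoc]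
  rw [h4, h1, Matrix.mul_sub, Matrix.mul_add, Matrix.sub_mul, Matrix.add_mul, Matrix.trace_sub,
    Matrix.trace_add, h5, h6, h7]
  simp only [Complex.sub_re, Complex.add_re, Complex.star_def, Complex.conj_re]
  ring

end MeanValue

/-! ### The Gramian formula for the cost and its smoothness. -/

namespace LTISystem

variable {n m r : ℕ} (S : LTISystem n m r)

/-- The observability Gramian of the closed loop. -/
def gramian (K : Matrix (Fin m) (Fin n) ℝ) : Matrix (Fin n) (Fin n) ℝ :=
  lyapSol (S.AK K) ((S.CK K)ᵀ * S.CK K)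

/-- The energy of the first `N` terms of the closed-loop impulse response. -/
def impulseEnergy (N : ℕ) (K : Matrix (Fin m) (Fin n) ℝ) : ℝ :=
  ∑ k ∈ Finset.range N,
    ((S.CK K * S.AK K ^ k * S.G)ᵀ * (S.CK K * S.AK K ^ k * S.G)).trace

theorem trace_transpose_mul_self {p q : Type*} [Fintype p] [Fintype q] (X : Matrix p q ℝ) :
    (Xᵀ * X).trace = ∑ j, ∑ i, X i j ^ 2 := by
  simp [Matrix.trace, Matrix.mul_apply, sq]

theorem trace_transpose_mul_self_nonneg {p q : Type*} [Fintype p] [Fintype q] (X : Matrix p q ℝ) :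
    0 ≤ (Xᵀ * X).trace := by
  rw [trace_transpose_mul_self]; positivity

theorem sq_apply_le_trace {p q : Type*} [Fintype p] [Fintype q] (X : Matrix p q ℝ) (i : p)
    (j : q) : X i j ^ 2 ≤ (Xᵀ * X).trace := by
  rw [trace_transpose_mul_self]
  refine le_trans ?_ (Finset.single_le_sum (f := fun j => ∑ i, X i j ^ 2)
    (fun _ _ => by positivity) (Finset.mem_univ j))
  exact Finset.single_le_sum (f := fun i => X i j ^ 2) (fun _ _ => by positivity)
    (Finset.mem_univ i)

theorem impulseEnergy_mono (K : Matrix (Fin m) (Fin n) ℝ) :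
    Monotone fun N => S.impulseEnergy N K := by
  refine monotone_nat_of_le_succ fun N => ?_
  simp only [impulseEnergy, Finset.sum_range_succ]
  linarith [trace_transpose_mul_self_nonneg (S.CK K * S.AK K ^ N * S.G)]

/-- Unlike the Gramian formula for `J`, this needs no stability, which is why energy sublevel sets
are closed in the whole space. -/
theorem continuous_impulseEnergy (N : ℕ) : Continuous (S.impulseEnergy N) := by
  unfold impulseEnergy CK AK
  fun_prop

variable {S}

theorem gramian_eq {K : Matrix (Fin m) (Fin n) ℝ} (hK : K ∈ S.stabGains) :
    S.gramian K = (S.AK K)ᵀ * S.gramian K * S.AK K + (S.CK K)ᵀ * S.CK K :=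
  IsSchur.lyapSol_eq hK _

theorem gramian_transpose {K : Matrix (Fin m) (Fin n) ℝ} (hK : K ∈ S.stabGains) :
    (S.gramian K)ᵀ = S.gramian K :=
  IsSchur.lyapSol_transpose hK (by simp)

theorem tendsto_impulseEnergy {K : Matrix (Fin m) (Fin n) ℝ} (hK : K ∈ S.stabGains) :
    Tendsto (fun N => S.impulseEnergy N K) atTop (𝓝 ((S.Gᵀ * S.gramian K * S.G).trace)) := by
  have h1 : ∀ N, S.impulseEnergy N K = (S.Gᵀ * (S.gramian K -
      ((S.AK K ^ N)ᵀ * S.gramian K * S.AK K ^ N)) * S.G).trace := by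
    intro N
    have h2 := sub_eq_iff_eq_add.2 (lyap_iterate (gramian_eq hK) N)
    rw [h2, Matrix.mul_sum, Matrix.sum_mul, Matrix.trace_sum, impulseEnergy]
    refine Finset.sum_congr rfl fun k _ => ?_
    simp only [Matrix.transpose_mul, Matrix.mul_assoc]
  simp_rw [h1]
  have hc : Continuous fun X : Matrix (Fin n) (Fin n) ℝ =>
      (S.Gᵀ * (S.gramian K - X) * S.G).trace := by fun_prop
  have := (hc.tendsto 0).comp (IsSchur.tendsto_conj_pow hK (S.gramian K))
  rw [sub_zero] at this
  exact this

theorem impulseEnergy_le_trace {K : Matrix (Fin m) (Fin n) ℝ} (hK : K ∈ S.stabGains) (N : ℕ) :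
    S.impulseEnergy N K ≤ (S.Gᵀ * S.gramian K * S.G).trace :=
  (S.impulseEnergy_mono K).ge_of_tendsto (tendsto_impulseEnergy hK) N

/-- With `w = z⁻¹` on the unit circle, `(zI - A_K)⁻¹ = w (1 - w A_K)⁻¹`, and the outer factor `w`
disappears from the squared norm. -/
theorem trace_transfer {K : Matrix (Fin m) (Fin n) ℝ} (hK : K ∈ S.stabGains) (θ : ℝ) :
    (Matrix.trace ((S.transfer K (Complex.exp (Complex.I * θ)))ᴴ *
      S.transfer K (Complex.exp (Complex.I * θ)))).re =
    2 * (((S.G * S.Gᵀ * S.gramian K).map Complex.ofReal *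
      (1 - Complex.exp (-(Complex.I * θ)) • (S.AK K).map Complex.ofReal)⁻¹).trace).re -
      (S.G * S.Gᵀ * S.gramian K).trace := by
  set z := Complex.exp (Complex.I * θ) with hz
  set w := Complex.exp (-(Complex.I * θ)) with hw
  have hzw : z * w = 1 := by rw [hz, hw, ← Complex.exp_add]; simp
  have hwn : ‖w‖ ≤ 1 := by rw [hw]; simp [Complex.norm_exp]
  have hw1 : star w * w = 1 := by
    rw [Complex.star_def, mul_comm, Complex.mul_conj, Complex.normSq_eq_norm_sq]
    simp [hw, Complex.norm_exp]
  set A := (S.AK K).map Complex.ofReal with hA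
  set C := (S.CK K).map Complex.ofReal with hC
  set G := S.G.map Complex.ofReal with hG
  set P := (S.gramian K).map Complex.ofReal with hP
  set W := (1 - w • A)⁻¹ with hWdef
  have hct : ∀ {p q : ℕ} (X : Matrix (Fin p) (Fin q) ℝ),
      (X.map Complex.ofReal)ᴴ = Xᵀ.map Complex.ofReal := by
    intro p q X; ext i j; simp
  have hmul : ∀ {p q s : ℕ} (X : Matrix (Fin p) (Fin q) ℝ) (Y : Matrix (Fin q) (Fin s) ℝ),
      (X * Y).map Complex.ofReal = X.map Complex.ofReal * Y.map Complex.ofReal := by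
    intro p q s X Y
    exact Matrix.map_mul (f := Complex.ofRealHom)
  have hadd : ∀ {p q : ℕ} (X Y : Matrix (Fin p) (Fin q) ℝ),
      (X + Y).map Complex.ofReal = X.map Complex.ofReal + Y.map Complex.ofReal := by
    intro p q X Y; ext i j; simp
  have hu : IsUnit (1 - w • A).det :=
    isUnit_iff_ne_zero.2 (IsSchur.det_one_sub_smul_ne_zero hK hwn)
  have hW : W = 1 + w • (A * W) := by
    have := Matrix.mul_nonsing_inv _ hu
    rw [← hWdef, Matrix.sub_mul, Matrix.one_mul, sub_eq_iff_eq_add, Matrix.smul_mul] at this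
    exact this
  have hinv : (z • (1 : Matrix (Fin n) (Fin n) ℂ) - A)⁻¹ = w • W := by
    apply Matrix.inv_eq_right_inv
    have h1 : z • (1 : Matrix (Fin n) (Fin n) ℂ) - A = z • (1 - w • A) := by
      rw [smul_sub, smul_smul, hzw, one_smul]
    rw [h1, Matrix.smul_mul, Matrix.mul_smul, smul_smul, hzw, one_smul,
      Matrix.mul_nonsing_inv _ hu]
  have hT : S.transfer K z = w • (C * W * G) := by
    rw [transfer, ← hA, ← hC, ← hG, hinv, Matrix.mul_smul, Matrix.smul_mul]
  have hTT : (S.transfer K z)ᴴ * S.transfer K z = (C * W * G)ᴴ * (C * W * G) := by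
    rw [hT, Matrix.conjTranspose_smul, Matrix.smul_mul, Matrix.mul_smul, smul_smul, hw1, one_smul]
  have hPs : Pᴴ = P := by rw [hP, hct, gramian_transpose hK]
  have hL : P = Aᴴ * P * A + Cᴴ * C := by
    rw [hA, hC, hct, hct, hP, ← hmul, ← hmul, ← hmul, ← hadd, ← gramian_eq hK]
  rw [hTT, trace_conjTranspose_mul_self_re hPs hL hW hw1]
  have hN : (S.G * S.Gᵀ * S.gramian K).map Complex.ofReal = G * Gᴴ * P := by
    rw [hmul, hmul, hG, hct]
  rw [hN]
  congr 1
  rw [← hN]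
  simp [Matrix.trace]

theorem J_eq_trace {K : Matrix (Fin m) (Fin n) ℝ} (hK : K ∈ S.stabGains) :
    S.J K = (S.Gᵀ * S.gramian K * S.G).trace := by
  have hval : (1 / (2 * Real.pi)) * ∫ θ in (-Real.pi)..Real.pi,
      (Matrix.trace ((S.transfer K (Complex.exp (Complex.I * θ)))ᴴ *
        S.transfer K (Complex.exp (Complex.I * θ)))).re = (S.Gᵀ * S.gramian K * S.G).trace := by
    simp_rw [trace_transfer hK]
    set N := (S.G * S.Gᵀ * S.gramian K) with hN
    have hc := IsSchur.continuous_trace_resolvent hK (N.map Complex.ofReal)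
    have hint := Complex.reCLM.intervalIntegral_comp_comm
      (hc.intervalIntegrable (μ := MeasureTheory.volume) (-Real.pi) Real.pi)
    rw [IsSchur.integral_trace_resolvent hK] at hint
    simp only [Complex.reCLM_apply] at hint
    rw [intervalIntegral.integral_sub, intervalIntegral.integral_const_mul, hint,
      intervalIntegral.integral_const]
    · have h1 : (N.map Complex.ofReal).trace = (N.trace : ℂ) := by simp [Matrix.trace]
      rw [h1, show (S.Gᵀ * S.gramian K * S.G).trace = N.trace by
        rw [Matrix.trace_mul_comm, ← Matrix.mul_assoc]]
      rw [show (2 * (Real.pi : ℂ) * (N.trace : ℂ)) = ((2 * Real.pi * N.trace : ℝ) : ℂ) by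
        push_cast; ring, Complex.ofReal_re, smul_eq_mul]
      have := Real.pi_ne_zero
      field_simp
      ring
    · exact ((Complex.continuous_re.comp hc).const_mul 2).intervalIntegrable _ _
    · exact intervalIntegrable_const
  rw [J, h2Norm, Real.sq_sqrt, hval]
  rw [hval]
  -- The empty energy sum gives the nonnegativity needed to square the square root.
  simpa [impulseEnergy] using impulseEnergy_le_trace hK 0

theorem impulseEnergy_le_J {K : Matrix (Fin m) (Fin n) ℝ} (hK : K ∈ S.stabGains) (N : ℕ) :
    S.impulseEnergy N K ≤ S.J K :=
  (impulseEnergy_le_trace hK N).trans_eq (J_eq_trace hK).symm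

theorem J_nonneg (K : Matrix (Fin m) (Fin n) ℝ) : 0 ≤ S.J K := sq_nonneg _

theorem isOpen_stabGains : IsOpen S.stabGains := by
  have hc : Continuous S.AK := by unfold AK; fun_prop
  exact isOpen_isSchur.preimage hc

theorem continuous_matGain : Continuous (matGain : GainVec n m → Matrix (Fin m) (Fin n) ℝ) := by
  refine continuous_matrix fun i j => ?_
  simp only [matGain, Matrix.of_apply]
  fun_prop

theorem continuous_vecGain : Continuous (vecGain : Matrix (Fin m) (Fin n) ℝ → GainVec n m) := by
  refine (PiLp.continuous_toLp 2 _).comp (continuous_pi fun p => ?_)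
  simp only [Matrix.vec]
  fun_prop

/-- Near a stabilising gain `J` agrees with the Gramian formula, whose entries are rational in `K`
with the nonvanishing denominator `det (lyapMatrix A_K)`. -/
theorem contDiffAt_J {K : Matrix (Fin m) (Fin n) ℝ} (hK : K ∈ S.stabGains) :
    ContDiffAt ℝ ∞ (fun x => S.J (matGain x)) (vecGain K) := by
  have hev : (fun x => S.J (matGain x)) =ᶠ[𝓝 (vecGain K)]
      fun x => (S.Gᵀ * S.gramian (matGain x) * S.G).trace := by
    have hmem : {x : GainVec n m | matGain x ∈ S.stabGains} ∈ 𝓝 (vecGain K) :=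
      (isOpen_stabGains.preimage continuous_matGain).mem_nhds (by
        rw [Set.mem_preimage, matGain_vecGain]; exact hK)
    filter_upwards [hmem] with x hx using J_eq_trace hx
  refine ContDiffAt.congr_of_eventuallyEq ?_ hev
  have hm : ∀ i j, ContDiffAt ℝ ∞ (fun x : GainVec n m => matGain x i j) (vecGain K) := by
    intro i j
    simp only [matGain, Matrix.of_apply]
    fun_prop
  have hA : ∀ i j, ContDiffAt ℝ ∞ (fun x : GainVec n m => S.AK (matGain x) i j) (vecGain K) := by
    intro i j
    simp only [AK, Matrix.sub_apply]
    exact contDiffAt_const.sub (contDiffAt_const_matrix_mul_apply _ hm i j)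
  have hC : ∀ i j, ContDiffAt ℝ ∞ (fun x : GainVec n m => S.CK (matGain x) i j) (vecGain K) := by
    intro i j
    simp only [CK, Matrix.sub_apply]
    exact contDiffAt_const.sub (contDiffAt_const_matrix_mul_apply _ hm i j)
  have hP : ∀ i j, ContDiffAt ℝ ∞ (fun x : GainVec n m => S.gramian (matGain x) i j)
      (vecGain K) := by
    intro i j
    simp only [gramian, lyapSol, Matrix.of_apply, Matrix.mulVec, dotProduct, Matrix.vec]
    refine ContDiffAt.sum fun p _ => ContDiffAt.mul
      (contDiffAt_matrix_inv_apply (fun a b => ?_) ?_ _ _)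
      (contDiffAt_matrix_mul_apply (fun a b => hC b a) hC _ _)
    · simp only [lyapMatrix, Matrix.sub_apply, Matrix.kroneckerMap_apply, Matrix.transpose_apply]
      exact contDiffAt_const.sub ((hA _ _).mul (hA _ _))
    · rw [matGain_vecGain]
      exact IsSchur.det_lyapMatrix_ne_zero hK
  simp only [Matrix.trace, Matrix.diag_apply]
  exact ContDiffAt.sum fun i _ => contDiffAt_matrix_mul_const_apply _
    (contDiffAt_const_matrix_mul_apply _ hP) i i

end LTISystem

/-! ### Compactness of energy sublevel sets. -/

namespace LTISystem

variable {n m r : ℕ} (S : LTISystem n m r)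

/-- The gains whose closed-loop impulse response has energy at most `c`. -/
def energySublevel (c : ℝ) : Set (Matrix (Fin m) (Fin n) ℝ) := {K | ∀ N, S.impulseEnergy N K ≤ c}

theorem isClosed_energySublevel (c : ℝ) : IsClosed (S.energySublevel c) := by
  simp only [energySublevel, Set.ofPred_forall]
  exact isClosed_iInter fun N => isClosed_le (S.continuous_impulseEnergy N) continuous_const

variable {S}

theorem mem_energySublevel {K : Matrix (Fin m) (Fin n) ℝ} (hK : K ∈ S.stabGains) {c : ℝ}
    (hc : S.J K ≤ c) : K ∈ S.energySublevel c := fun N => (impulseEnergy_le_J hK N).trans hc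

theorem isUnit_det_of_posDef_mul_transpose {G : Matrix (Fin n) (Fin n) ℝ}
    (hG : (G * Gᵀ).PosDef) : IsUnit G.det := by
  have h := hG.det_pos
  rw [Matrix.det_mul, Matrix.det_transpose] at h
  exact isUnit_iff_ne_zero.2 fun h0 => by simp [h0] at h

/-- The term of index zero bounds the entries of `C_K G`, and `Dᵀ C_K = -Dᵀ D K` recovers `K` from
that matrix by the continuous map `F`. -/
theorem isCompact_energySublevel (hDC : S.Dᵀ * S.C = 0) (hDD : (S.Dᵀ * S.D).PosDef)
    (hGG : (S.G * S.Gᵀ).PosDef) (c : ℝ) : IsCompact (S.energySublevel c) := by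
  have hG := isUnit_det_of_posDef_mul_transpose hGG
  have hD : IsUnit (S.Dᵀ * S.D).det := isUnit_iff_ne_zero.2 hDD.det_pos.ne'
  let F : Matrix (Fin r) (Fin n) ℝ → Matrix (Fin m) (Fin n) ℝ := fun Y =>
    -((S.Dᵀ * S.D)⁻¹ * S.Dᵀ * Y * S.G⁻¹)
  have hF : Continuous F := by fun_prop
  have hbox : IsCompact {Y : Matrix (Fin r) (Fin n) ℝ | ∀ i j, Y i j ∈ Set.Icc (-√c) √c} := by
    have h := isCompact_univ_pi fun _ : Fin r => isCompact_univ_pi fun _ : Fin n =>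
      isCompact_Icc (a := -√c) (b := √c)
    simp only [Set.pi, Set.mem_univ, true_imp_iff] at h
    exact h
  refine (hbox.image hF).of_isClosed_subset (S.isClosed_energySublevel c) fun K hK => ?_
  refine ⟨S.CK K * S.G, fun i j => ?_, ?_⟩
  · have h1 := hK 1
    simp only [impulseEnergy, Finset.range_one, Finset.sum_singleton, pow_zero, Matrix.mul_one] at h1
    exact abs_le.1 (Real.abs_le_sqrt ((sq_apply_le_trace _ i j).trans h1))
  · change -((S.Dᵀ * S.D)⁻¹ * S.Dᵀ * (S.CK K * S.G) * S.G⁻¹) = K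
    have h1 : S.Dᵀ * S.CK K = -(S.Dᵀ * S.D * K) := by
      rw [CK, Matrix.mul_sub, hDC, zero_sub, Matrix.mul_assoc]
    rw [← Matrix.mul_assoc, Matrix.mul_nonsing_inv_cancel_right _ _ hG, Matrix.mul_assoc, h1,
      Matrix.mul_neg, neg_neg, Matrix.nonsing_inv_mul_cancel_left _ _ hD]

theorem tendsto_impulse_of_mem_energySublevel (hGG : (S.G * S.Gᵀ).PosDef) {c : ℝ}
    {K : Matrix (Fin m) (Fin n) ℝ} (hK : K ∈ S.energySublevel c) :
    Tendsto (fun k : ℕ => S.CK K * S.AK K ^ k) atTop (𝓝 0) := by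
  have hG := isUnit_det_of_posDef_mul_transpose hGG
  have hs : Summable fun k : ℕ =>
      ((S.CK K * S.AK K ^ k * S.G)ᵀ * (S.CK K * S.AK K ^ k * S.G)).trace :=
    summable_of_sum_range_le (fun _ => trace_transpose_mul_self_nonneg _) hK
  have h0 := hs.tendsto_atTop_zero
  have h1 : Tendsto (fun k : ℕ => S.CK K * S.AK K ^ k * S.G) atTop (𝓝 0) := by
    refine tendsto_pi_nhds.2 fun i => tendsto_pi_nhds.2 fun j => ?_
    refine squeeze_zero_norm (fun k => ?_) (by simpa only [Real.sqrt_zero] using h0.sqrt)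
    exact Real.abs_le_sqrt (sq_apply_le_trace _ i j)
  have hc : Continuous fun X : Matrix (Fin r) (Fin n) ℝ => X * S.G⁻¹ := by fun_prop
  have h2 := (hc.tendsto 0).comp h1
  rw [Matrix.zero_mul] at h2
  refine h2.congr fun k => ?_
  exact Matrix.mul_nonsing_inv_cancel_right _ _ hG

/-- Suppose `A_K v = z v` with `‖z‖ ≥ 1`. Finite energy gives `z ^ k • C_K v → 0`, so `C_K v = 0`.
Then `K v = 0` and `C v = 0`, so `v` is an eigenvector of `A - L C` for every `L`, against
detectability. -/
theorem energySublevel_subset_stabGains (hDC : S.Dᵀ * S.C = 0) (hDD : (S.Dᵀ * S.D).PosDef)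
    (hGG : (S.G * S.Gᵀ).PosDef) (hdet : S.Detectable) (c : ℝ) :
    S.energySublevel c ⊆ S.stabGains := by
  intro K hK z hz
  obtain ⟨v, hv, hAv⟩ := (Matrix.mem_spectrum_iff_exists_mulVec _ _).1 hz
  by_contra! hz1
  have hmul : ∀ {p q s : ℕ} (X : Matrix (Fin p) (Fin q) ℝ) (Y : Matrix (Fin q) (Fin s) ℝ),
      (X * Y).map Complex.ofReal = X.map Complex.ofReal * Y.map Complex.ofReal :=
    fun X Y => Matrix.map_mul (f := Complex.ofRealHom)
  have hsub : ∀ {p q : ℕ} (X Y : Matrix (Fin p) (Fin q) ℝ),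
      (X - Y).map Complex.ofReal = X.map Complex.ofReal - Y.map Complex.ofReal := by
    intro p q X Y; ext i j; simp
  have hCv : (S.CK K).map Complex.ofReal *ᵥ v = 0 := by
    have hc : Continuous fun X : Matrix (Fin r) (Fin n) ℝ => X.map Complex.ofReal *ᵥ v :=
      (continuous_id.matrix_map Complex.continuous_ofReal).matrix_mulVec continuous_const
    have h1 := (hc.tendsto 0).comp (tendsto_impulse_of_mem_energySublevel hGG hK)
    have h2 : ((fun X : Matrix (Fin r) (Fin n) ℝ => X.map Complex.ofReal *ᵥ v) ∘
        fun k : ℕ => S.CK K * S.AK K ^ k) =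
        fun k : ℕ => z ^ k • ((S.CK K).map Complex.ofReal *ᵥ v) := by
      ext1 k
      rw [Function.comp_apply, hmul, Matrix.map_ofReal_pow, ← Matrix.mulVec_mulVec,
        Matrix.pow_mulVec_of_mulVec_eq_smul hAv, Matrix.mulVec_smul]
    rw [h2] at h1
    have h3 : Tendsto (fun k : ℕ => z ^ k • ((S.CK K).map Complex.ofReal *ᵥ v)) atTop (𝓝 0) := by
      convert! h1 using 2
      ext i; simp
    have h4 := (tendsto_zero_iff_norm_tendsto_zero.1 h3)
    have h5 : ‖(S.CK K).map Complex.ofReal *ᵥ v‖ ≤ 0 := by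
      refine ge_of_tendsto' h4 fun k => ?_
      rw [norm_smul, norm_pow]
      exact le_mul_of_one_le_left (norm_nonneg _) (one_le_pow₀ hz1)
    exact norm_le_zero_iff.1 h5
  have hKv : K.map Complex.ofReal *ᵥ v = 0 := by
    have h1 : (S.Dᵀ * S.CK K) = -(S.Dᵀ * S.D * K) := by
      rw [CK, Matrix.mul_sub, hDC, zero_sub, Matrix.mul_assoc]
    have hD : IsUnit (S.Dᵀ * S.D).det := isUnit_iff_ne_zero.2 hDD.det_pos.ne'
    have h2 : K = -((S.Dᵀ * S.D)⁻¹ * S.Dᵀ) * S.CK K := by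
      rw [Matrix.neg_mul, Matrix.mul_assoc, h1, Matrix.mul_neg, neg_neg,
        Matrix.nonsing_inv_mul_cancel_left _ _ hD]
    rw [h2, hmul, ← Matrix.mulVec_mulVec, hCv, Matrix.mulVec_zero]
  have hCv' : S.C.map Complex.ofReal *ᵥ v = 0 := by
    rw [CK, hsub, hmul, Matrix.sub_mulVec, ← Matrix.mulVec_mulVec, hKv, Matrix.mulVec_zero,
      sub_zero] at hCv
    exact hCv
  obtain ⟨L, hL⟩ := hdet
  have := hL z ((Matrix.mem_spectrum_iff_exists_mulVec _ _).2 ⟨v, hv, by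
    rw [hsub, hmul, Matrix.sub_mulVec, ← Matrix.mulVec_mulVec, hCv', Matrix.mulVec_zero, sub_zero,
      ← hAv, AK, hsub, hmul, Matrix.sub_mulVec, ← Matrix.mulVec_mulVec, hKv, Matrix.mulVec_zero,
      sub_zero]⟩)
  linarith

/-! ### The constraints and the logarithmic barrier. -/

variable (S)

theorem slack_inl (K : Matrix (Fin m) (Fin n) ℝ) (i j : Fin n) :
    S.slack K (Sum.inl i) j = S.AK K i j := rfl

theorem slack_inr (K : Matrix (Fin m) (Fin n) ℝ) (i : Unit) (j : Fin n) :
    S.slack K (Sum.inr i) j = 1 - ∑ i, S.AK K i j := by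
  simp [slack, onesRow, Matrix.mul_apply]

theorem continuous_slack_apply (i : Fin n ⊕ Unit) (j : Fin n) :
    Continuous fun K => S.slack K i j := by
  rcases i with i | i
  · simp only [slack_inl, AK]; fun_prop
  · simp only [slack_inr, AK]; fun_prop

theorem isOpen_strictlyFeasible : IsOpen {K | S.StrictlyFeasible K} := by
  simp only [StrictlyFeasible, Set.ofPred_forall]
  exact isOpen_iInter_of_finite fun i => isOpen_iInter_of_finite fun j =>
    isOpen_lt continuous_const (S.continuous_slack_apply i j)

variable {S}

theorem StrictlyFeasible.mem_stabGains {K : Matrix (Fin m) (Fin n) ℝ}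
    (h : S.StrictlyFeasible K) : K ∈ S.stabGains := by
  refine isSchur_of_colSum_lt_one (fun i j => (h (Sum.inl i) j).le) fun j => ?_
  have := h (Sum.inr ()) j
  rw [slack_inr] at this
  linarith

/-- Each column of the slack matrix has positive entries with sum one. This gives all logarithms a
sign. -/
theorem StrictlyFeasible.slack_le_one {K : Matrix (Fin m) (Fin n) ℝ}
    (h : S.StrictlyFeasible K) (i : Fin n ⊕ Unit) (j : Fin n) : S.slack K i j ≤ 1 := by
  have h1 := h (Sum.inr ()) j
  rw [slack_inr] at h1
  have h2 : ∀ i, 0 ≤ S.AK K i j := fun i => (h (Sum.inl i) j).le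
  rcases i with i | i
  · rw [slack_inl]
    have := Finset.single_le_sum (f := fun i => S.AK K i j) (fun i _ => h2 i) (Finset.mem_univ i)
    linarith
  · rw [slack_inr]
    have := Finset.sum_nonneg fun i (_ : i ∈ Finset.univ) => h2 i
    linarith

theorem StrictlyFeasible.log_slack_nonpos {K : Matrix (Fin m) (Fin n) ℝ}
    (h : S.StrictlyFeasible K) (i : Fin n ⊕ Unit) (j : Fin n) : Real.log (S.slack K i j) ≤ 0 :=
  Real.log_nonpos (h i j).le (h.slack_le_one i j)

theorem StrictlyFeasible.sum_log_slack_nonpos {K : Matrix (Fin m) (Fin n) ℝ}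
    (h : S.StrictlyFeasible K) : ∑ i, ∑ j, Real.log (S.slack K i j) ≤ 0 :=
  Finset.sum_nonpos fun i _ => Finset.sum_nonpos fun j _ => h.log_slack_nonpos i j

theorem StrictlyFeasible.J_le_JLBF {K : Matrix (Fin m) (Fin n) ℝ}
    (h : S.StrictlyFeasible K) {t : ℝ} (ht : 0 < t) : S.J K ≤ S.JLBF K t := by
  have := mul_nonpos_of_nonneg_of_nonpos (one_div_pos.2 ht).le h.sum_log_slack_nonpos
  rw [JLBF]; linarith

/-- As `J ≥ 0` and no logarithm is positive, a bound on the barrier objective bounds each logarithm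
separately. -/
theorem StrictlyFeasible.exp_le_slack {K : Matrix (Fin m) (Fin n) ℝ}
    (h : S.StrictlyFeasible K) {t c : ℝ} (ht : 0 < t) (hc : S.JLBF K t ≤ c) (i : Fin n ⊕ Unit)
    (j : Fin n) : Real.exp (-(t * c)) ≤ S.slack K i j := by
  rw [← Real.le_log_iff_exp_le (h i j)]
  have h1 : ∑ i, ∑ j, Real.log (S.slack K i j) ≤ Real.log (S.slack K i j) := by
    rw [← neg_le_neg_iff]
    simp only [← Finset.sum_neg_distrib]
    refine le_trans ?_ (Finset.single_le_sum (f := fun i => ∑ j, -Real.log (S.slack K i j))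
      (fun i _ => Finset.sum_nonneg fun j _ => neg_nonneg.2 (h.log_slack_nonpos i j))
      (Finset.mem_univ i))
    exact Finset.single_le_sum (f := fun j => -Real.log (S.slack K i j))
      (fun j _ => neg_nonneg.2 (h.log_slack_nonpos i j)) (Finset.mem_univ j)
  refine le_trans ?_ h1
  have h2 := J_nonneg (S := S) K
  rw [JLBF] at hc
  have h3 : -c ≤ (1 / t) * ∑ i, ∑ j, Real.log (S.slack K i j) := by linarith
  have h4 := mul_le_mul_of_nonneg_left h3 ht.le
  rwa [← mul_assoc, mul_one_div_cancel ht.ne', one_mul, mul_neg] at h4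

/-- Sublevel sets of the log-barrier objective lie in compact sets of strictly feasible gains. -/
theorem exists_isCompact_JLBF_sublevel (hDC : S.Dᵀ * S.C = 0) (hDD : (S.Dᵀ * S.D).PosDef)
    (hGG : (S.G * S.Gᵀ).PosDef) {t : ℝ} (ht : 0 < t) (c : ℝ) :
    ∃ Z : Set (Matrix (Fin m) (Fin n) ℝ), IsCompact Z ∧ Z ⊆ {K | S.StrictlyFeasible K} ∧
      ∀ K, S.StrictlyFeasible K → S.JLBF K t ≤ c → K ∈ Z := by
  refine ⟨S.energySublevel c ∩ {K | ∀ i j, Real.exp (-(t * c)) ≤ S.slack K i j},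
    (isCompact_energySublevel hDC hDD hGG c).inter_right ?_, fun K hK i j =>
      (Real.exp_pos _).trans_le (hK.2 i j), fun K hK hc =>
      ⟨mem_energySublevel hK.mem_stabGains ((hK.J_le_JLBF ht).trans hc), hK.exp_le_slack ht hc⟩⟩
  simp only [Set.ofPred_forall]
  exact isClosed_iInter fun i => isClosed_iInter fun j =>
    isClosed_le continuous_const (S.continuous_slack_apply i j)

variable (S)

/-- The linear part of the constraint map. -/
def slackDir (V : Matrix (Fin m) (Fin n) ℝ) : Matrix (Fin n ⊕ Unit) (Fin n) ℝ :=
  Matrix.fromRows (-(S.B * V)) (onesRow n * (S.B * V))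

theorem slack_add (K V : Matrix (Fin m) (Fin n) ℝ) :
    S.slack (K + V) = S.slack K + S.slackDir V := by
  ext i j
  rcases i with i | i
  · simp [slack, slackDir, AK, Matrix.mul_add]; ring
  · simp [slack, slackDir, AK, Matrix.mul_add, Matrix.mul_sub]; ring

/-- Entries of the constraint map, differentiated. -/
def slackDeriv (i : Fin n ⊕ Unit) (j : Fin n) : GainVec n m →L[ℝ] ℝ :=
  LinearMap.toContinuousLinearMap
    { toFun := fun v => S.slackDir (matGain v) i j
      map_add' := fun v w => by
        have : matGain (v + w) = matGain v + matGain w := rfl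
        rw [this]
        rcases i with i | i <;> simp [slackDir, Matrix.mul_add]; ring
      map_smul' := fun a v => by
        have : matGain (a • v) = a • matGain v := rfl
        rw [this]
        rcases i with i | i <;> simp [slackDir] }

theorem slackDeriv_apply (i : Fin n ⊕ Unit) (j : Fin n) (v : GainVec n m) :
    S.slackDeriv i j v = S.slackDir (matGain v) i j := rfl

theorem slack_matGain (i : Fin n ⊕ Unit) (j : Fin n) (x : GainVec n m) :
    S.slack (matGain x) i j = S.slack 0 i j + S.slackDeriv i j x := by
  rw [slackDeriv_apply, ← Matrix.add_apply, ← slack_add, zero_add]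

theorem hasFDerivAt_slack (i : Fin n ⊕ Unit) (j : Fin n) (x : GainVec n m) :
    HasFDerivAt (fun x => S.slack (matGain x) i j) (S.slackDeriv i j) x := by
  simp only [slack_matGain]
  exact (S.slackDeriv i j).hasFDerivAt.const_add _

/-- `dualTerm` is the adjoint of `slackDir`. -/
theorem inner_vecGain_dualTerm (Q : Matrix (Fin n ⊕ Unit) (Fin n) ℝ) (v : GainVec n m) :
    inner ℝ (vecGain (S.dualTerm Q)) v = ∑ i, ∑ j, Q i j * S.slackDir (matGain v) i j := by
  have h1 : ∀ X Y : Matrix (Fin m) (Fin n) ℝ, inner ℝ (vecGain X) (vecGain Y) = (Xᵀ * Y).trace := by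
    intro X Y
    simp only [PiLp.inner_apply, vecGain, Matrix.vec, Fintype.sum_prod_type, Matrix.trace,
      Matrix.diag_apply, Matrix.mul_apply, Matrix.transpose_apply]
    refine Finset.sum_congr rfl fun i _ => Finset.sum_congr rfl fun j _ => ?_
    simp [mul_comm]
  have h2 : ∑ i, ∑ j, Q i j * S.slackDir (matGain v) i j = (Qᵀ * S.slackDir (matGain v)).trace := by
    rw [Finset.sum_comm]
    simp [Matrix.trace, Matrix.mul_apply]
  rw [h2]
  conv_lhs => rw [← vecGain_matGain v, h1]
  have h3 : S.slackDir (matGain v) =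
      (Matrix.fromCols (-S.Bᵀ) (S.Bᵀ * (onesRow n)ᵀ))ᵀ * matGain v := by
    rw [Matrix.transpose_fromCols, Matrix.fromRows_mul, slackDir]
    simp [Matrix.mul_assoc]
  rw [h3, dualTerm, Matrix.transpose_mul, Matrix.mul_assoc]

variable {S}

theorem inner_gradJ {K : Matrix (Fin m) (Fin n) ℝ} (v : GainVec n m) :
    inner ℝ (S.gradJ K) v = fderiv ℝ (fun x => S.J (matGain x)) (vecGain K) v := by
  rw [gradJ, gradient, InnerProductSpace.toDual_symm_apply]

theorem StrictlyFeasible.contDiffAt_JLBF {K : Matrix (Fin m) (Fin n) ℝ}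
    (h : S.StrictlyFeasible K) (t : ℝ) :
    ContDiffAt ℝ ∞ (fun x => S.JLBF (matGain x) t) (vecGain K) := by
  unfold JLBF
  refine (contDiffAt_J h.mem_stabGains).sub (contDiffAt_const.mul (ContDiffAt.sum fun i _ =>
    ContDiffAt.sum fun j _ => ContDiffAt.log ?_ ?_))
  · simp only [slack_matGain]
    exact contDiffAt_const.add (S.slackDeriv i j).contDiff.contDiffAt
  · rw [matGain_vecGain]; exact (h i j).ne'

/-- The multipliers attached to a strictly feasible gain by the barrier. -/
def barrierDual (S : LTISystem n m r) (K : Matrix (Fin m) (Fin n) ℝ) (t : ℝ) :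
    Matrix (Fin n ⊕ Unit) (Fin n) ℝ := Matrix.of fun i j => 1 / (t * S.slack K i j)

/-- The barrier gradient is the KKT residual of `barrierDual`, so the inner stopping test measures
approximate stationarity. -/
theorem StrictlyFeasible.gradJLBF_eq {K : Matrix (Fin m) (Fin n) ℝ}
    (h : S.StrictlyFeasible K) (t : ℝ) :
    S.gradJLBF K t = S.gradJ K - vecGain (S.dualTerm (S.barrierDual K t)) := by
  refine ext_inner_right ℝ fun v => ?_
  have hJ := ((contDiffAt_J h.mem_stabGains).differentiableAt (by simp)).hasFDerivAt
  have hlog : ∀ i j, HasFDerivAt (fun x => Real.log (S.slack (matGain x) i j))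
      ((S.slack K i j)⁻¹ • S.slackDeriv i j) (vecGain K) := fun i j => by
    have := (S.hasFDerivAt_slack i j (vecGain K)).log (by rw [matGain_vecGain]; exact (h i j).ne')
    rwa [matGain_vecGain] at this
  have hsum := HasFDerivAt.fun_sum (u := Finset.univ) fun i _ =>
    HasFDerivAt.fun_sum (u := Finset.univ) fun j _ => hlog i j
  have hd := hJ.sub (hsum.const_mul (1 / t))
  rw [gradJLBF, gradient, InnerProductSpace.toDual_symm_apply, inner_sub_left, inner_gradJ,
    inner_vecGain_dualTerm]
  have : (fun x : GainVec n m => S.JLBF (matGain x) t) =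
    (fun x => S.J (matGain x)) - fun x => (1 / t) * ∑ i, ∑ j, Real.log (S.slack (matGain x) i j) :=
    rfl
  rw [this, hd.fderiv]
  simp only [sub_apply, smul_apply,
    sum_apply, slackDeriv_apply, smul_eq_mul, barrierDual, Matrix.of_apply,
    Finset.mul_sum]
  congr 1
  refine Finset.sum_congr rfl fun i _ => Finset.sum_congr rfl fun j _ => ?_
  rw [one_div, one_div, mul_inv, mul_assoc]

end LTISystem

/-! ### Bounds for the modified Newton direction. -/

section EigenvalueFloor

variable {ι : Type*} [Fintype ι] [DecidableEq ι]

theorem exists_isEigenvalueFloor (δ : ℝ) {H : Matrix ι ι ℝ} (hH : H.IsHermitian) :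
    ∃ H', IsEigenvalueFloor δ H H' := by
  refine ⟨_, hH.eigenvectorUnitary, hH.eigenvectorUnitary.2, hH.eigenvalues, ?_, rfl⟩
  have := hH.spectral_theorem
  rw [Unitary.conjStarAlgAut_apply] at this
  exact this

/-- In the coordinates `u = Qᵀ g` the floored matrix is diagonal with entries `τ`, so all three
quantities become coordinate sums. -/
theorem IsEigenvalueFloor.exists_coords {δ : ℝ} (hδ : 0 < δ) {H H' : Matrix ι ι ℝ}
    (h : IsEigenvalueFloor δ H H') {M : ℝ} (hM : ∀ v : ι → ℝ, v ⬝ᵥ H *ᵥ v ≤ M * (v ⬝ᵥ v))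
    (g : ι → ℝ) : ∃ τ u : ι → ℝ, (∀ i, δ ≤ τ i ∧ τ i ≤ max M δ) ∧
      g ⬝ᵥ g = ∑ i, u i ^ 2 ∧ g ⬝ᵥ (H'⁻¹ *ᵥ g) = ∑ i, u i ^ 2 / τ i ∧
      (H'⁻¹ *ᵥ g) ⬝ᵥ (H'⁻¹ *ᵥ g) = ∑ i, (u i / τ i) ^ 2 := by
  obtain ⟨Q, hQ, σ, hH, hH'⟩ := h
  have hQ1 : Qᵀ * Q = 1 := (Matrix.mem_orthogonalGroup_iff' ι ℝ).1 hQ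
  have hQ2 : Q * Qᵀ = 1 := (Matrix.mem_orthogonalGroup_iff ι ℝ).1 hQ
  set τ : ι → ℝ := fun i => if δ ≤ σ i then σ i else δ with hτ
  have hτδ : ∀ i, δ ≤ τ i := fun i => by
    simp only [hτ]; split_ifs with h
    · exact h
    · exact le_rfl
  have hτ0 : ∀ i, τ i ≠ 0 := fun i => (hδ.trans_le (hτδ i)).ne'
  have hdot : ∀ x y : ι → ℝ, (Qᵀ *ᵥ x) ⬝ᵥ (Qᵀ *ᵥ y) = x ⬝ᵥ y := by
    intro x y
    rw [Matrix.dotProduct_mulVec, Matrix.vecMul_transpose, Matrix.mulVec_mulVec, hQ2,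
      Matrix.one_mulVec]
  have hinv : H'⁻¹ = Q * Matrix.diagonal (fun i => (τ i)⁻¹) * Qᵀ := by
    apply Matrix.inv_eq_right_inv
    rw [hH']
    have hd : Matrix.diagonal τ * Matrix.diagonal (fun i => (τ i)⁻¹) = 1 := by
      rw [Matrix.diagonal_mul_diagonal, ← Matrix.diagonal_one]
      congr 1; ext i; exact mul_inv_cancel₀ (hτ0 i)
    calc Q * Matrix.diagonal τ * Qᵀ * (Q * Matrix.diagonal (fun i => (τ i)⁻¹) * Qᵀ)
        = Q * Matrix.diagonal τ * (Qᵀ * Q) * Matrix.diagonal (fun i => (τ i)⁻¹) * Qᵀ := by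
          simp only [Matrix.mul_assoc]
      _ = 1 := by rw [hQ1, Matrix.mul_one, Matrix.mul_assoc Q, hd, Matrix.mul_one, hQ2]
  have hu : Qᵀ *ᵥ (H'⁻¹ *ᵥ g) = fun i => (Qᵀ *ᵥ g) i / τ i := by
    rw [hinv, Matrix.mulVec_mulVec, ← Matrix.mul_assoc, ← Matrix.mul_assoc, hQ1, Matrix.one_mul,
      ← Matrix.mulVec_mulVec]
    ext i
    rw [Matrix.mulVec_diagonal, div_eq_mul_inv, mul_comm]
  refine ⟨τ, Qᵀ *ᵥ g, fun i => ⟨hτδ i, ?_⟩, ?_, ?_, ?_⟩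
  · simp only [hτ]
    split_ifs with h
    · refine le_max_of_le_left ?_
      -- The quadratic form at the `i`-th column of `Q` is the eigenvalue `σ i`.
      have h1 := hM (Q *ᵥ Pi.single i 1)
      have h2 : Qᵀ *ᵥ (Q *ᵥ Pi.single i (1 : ℝ)) = Pi.single i 1 := by
        rw [Matrix.mulVec_mulVec, hQ1, Matrix.one_mulVec]
      rw [← hdot, ← hdot (Q *ᵥ Pi.single i 1) (Q *ᵥ Pi.single i 1), h2, hH,
        ← Matrix.mulVec_mulVec, h2, Matrix.mulVec_mulVec, ← Matrix.mul_assoc, hQ1,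
        Matrix.one_mul] at h1
      simpa using h1
    · exact le_max_right _ _
  · rw [← hdot]; simp [dotProduct, sq]
  · rw [← hdot, hu]
    simp only [dotProduct]
    exact Finset.sum_congr rfl fun i _ => by ring
  · rw [← hdot, hu]
    simp only [dotProduct, sq]

theorem IsEigenvalueFloor.direction_bounds {δ : ℝ} (hδ : 0 < δ) {H H' : Matrix ι ι ℝ}
    (h : IsEigenvalueFloor δ H H') {M : ℝ} (hM : ∀ v : ι → ℝ, v ⬝ᵥ H *ᵥ v ≤ M * (v ⬝ᵥ v))
    (g : EuclideanSpace ℝ ι) :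
    (max M δ)⁻¹ * ‖g‖ ^ 2 ≤ inner ℝ g (WithLp.toLp 2 (H'⁻¹ *ᵥ g.ofLp)) ∧
      ‖WithLp.toLp 2 (H'⁻¹ *ᵥ g.ofLp)‖ ≤ δ⁻¹ * ‖g‖ := by
  obtain ⟨τ, u, hτ, h1, h2, h3⟩ := h.exists_coords hδ hM g.ofLp
  have hin : ∀ x y : EuclideanSpace ℝ ι, inner ℝ x y = x.ofLp ⬝ᵥ y.ofLp := by
    intro x y; simp [PiLp.inner_apply, dotProduct, mul_comm]
  rw [← real_inner_self_eq_norm_sq, hin, hin, h1, h2]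
  refine ⟨?_, ?_⟩
  · rw [Finset.mul_sum]
    refine Finset.sum_le_sum fun i _ => ?_
    rw [inv_mul_eq_div]
    exact div_le_div_of_nonneg_left (sq_nonneg _) (hδ.trans_le (hτ i).1) (hτ i).2
  · refine le_of_sq_le_sq ?_ (by positivity)
    rw [mul_pow, ← real_inner_self_eq_norm_sq, ← real_inner_self_eq_norm_sq, hin, hin, h1, h3,
      Finset.mul_sum]
    refine Finset.sum_le_sum fun i _ => ?_
    rw [div_pow, inv_pow, inv_mul_eq_div]
    exact div_le_div_of_nonneg_left (sq_nonneg _) (by positivity)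
      (pow_le_pow_left₀ hδ.le (hτ i).1 2)

end EigenvalueFloor

/-! ### Gradients and Hessian matrices. -/

section Gradient

variable {E : Type*} [NormedAddCommGroup E] [InnerProductSpace ℝ E] [CompleteSpace E]

theorem ContDiffAt.gradient {f : E → ℝ} {x : E} (h : ContDiffAt ℝ ∞ f x) :
    ContDiffAt ℝ ∞ (gradient f) x :=
  (InnerProductSpace.toDual ℝ E).symm.contDiff.contDiffAt.comp x
    (h.fderiv_right (m := ∞) (by simp))

theorem inner_gradient_apply (f : E → ℝ) (x v : E) : inner ℝ (gradient f x) v = fderiv ℝ f x v := by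
  rw [_root_.gradient, InnerProductSpace.toDual_symm_apply]

theorem inner_fderiv_gradient {f : E → ℝ} {x : E} (h : ContDiffAt ℝ ∞ f x) (v w : E) :
    inner ℝ (fderiv ℝ (gradient f) x v) w = fderiv ℝ (fderiv ℝ f) x v w := by
  have h1 : HasFDerivAt (fun y => inner ℝ (gradient f y) w)
      ((innerSL ℝ w).comp (fderiv ℝ (gradient f) x)) x := by
    have := (innerSL ℝ w).hasFDerivAt.comp x
      (h.gradient.differentiableAt (by simp)).hasFDerivAt
    refine this.congr_of_eventuallyEq (Eventually.of_forall fun y => ?_)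
    simp
  have h2 : HasFDerivAt (fun y => fderiv ℝ f y w)
      ((ContinuousLinearMap.apply ℝ ℝ w).comp (fderiv ℝ (fderiv ℝ f) x)) x :=
    (ContinuousLinearMap.apply ℝ ℝ w).hasFDerivAt.comp x
      ((h.fderiv_right (m := ∞) (by simp)).differentiableAt (by simp)).hasFDerivAt
  simp_rw [inner_gradient_apply] at h1
  have := congrArg (fun L => L v) (h1.unique h2)
  rw [real_inner_comm]
  simpa using this

variable {ι : Type*} [Fintype ι] [DecidableEq ι]

theorem hessianMatrix_isHermitian {f : EuclideanSpace ℝ ι → ℝ} {x : EuclideanSpace ℝ ι}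
    (h : ContDiffAt ℝ ∞ f x) : (hessianMatrix f x).IsHermitian := by
  ext p q
  have h1 : ∀ p q, hessianMatrix f x p q = fderiv ℝ (fderiv ℝ f) x (EuclideanSpace.single q 1)
      (EuclideanSpace.single p 1) := by
    intro p q
    rw [← inner_fderiv_gradient h, EuclideanSpace.inner_single_right]
    simp [hessianMatrix]
  rw [Matrix.conjTranspose_apply, star_trivial, h1, h1]
  exact (h.isSymmSndFDerivAt (by
    rw [minSmoothness_of_isRCLikeNormedField]; exact WithTop.coe_le_coe.2 le_top)).eq _ _

theorem hessianMatrix_mulVec (f : EuclideanSpace ℝ ι → ℝ) (x v : EuclideanSpace ℝ ι) :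
    hessianMatrix f x *ᵥ v.ofLp = (fderiv ℝ (gradient f) x v).ofLp := by
  ext p
  have hv : v = ∑ q, v q • EuclideanSpace.single q (1 : ℝ) := by
    ext i; simp [Pi.single_apply]
  conv_rhs => rw [hv, map_sum]
  simp [Matrix.mulVec, dotProduct, hessianMatrix, mul_comm]

theorem hessianMatrix_quadratic_le (f : EuclideanSpace ℝ ι → ℝ) (x : EuclideanSpace ℝ ι)
    (v : ι → ℝ) :
    v ⬝ᵥ hessianMatrix f x *ᵥ v ≤ ‖fderiv ℝ (gradient f) x‖ * (v ⬝ᵥ v) := by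
  have hin : ∀ x y : EuclideanSpace ℝ ι, x.ofLp ⬝ᵥ y.ofLp = inner ℝ x y := by
    intro x y; simp [PiLp.inner_apply, dotProduct, mul_comm]
  have h1 := hessianMatrix_mulVec f x (WithLp.toLp 2 v)
  simp only at h1
  rw [h1, show v = (WithLp.toLp 2 v : EuclideanSpace ℝ ι).ofLp from rfl, hin, hin,
    real_inner_self_eq_norm_sq]
  refine (real_inner_le_norm _ _).trans ?_
  have := (fderiv ℝ (gradient f) x).le_opNorm (WithLp.toLp 2 v)
  nlinarith [norm_nonneg (WithLp.toLp 2 v : EuclideanSpace ℝ ι)]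

end Gradient

/-! ### Armijo backtracking. -/

section Armijo

variable {E : Type*} [NormedAddCommGroup E] [InnerProductSpace ℝ E]

theorem exists_armijo_step [CompleteSpace E] {f : E → ℝ} {U : Set E} {x d : E} {c ρ : ℝ}
    (hf : DifferentiableAt ℝ f x) (hU : U ∈ 𝓝 x) (hc : c < 1) (hρ : 0 < ρ) (hρ1 : ρ < 1)
    (hd : d ≠ 0 → 0 < inner ℝ (gradient f x) d) :
    ∃ i : ℕ, x - ρ ^ i • d ∈ U ∧
      f (x - ρ ^ i • d) ≤ f x - c * ρ ^ i * inner ℝ (gradient f x) d := by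
  rcases eq_or_ne d 0 with rfl | hd0
  · exact ⟨0, by simpa using mem_of_mem_nhds hU, by simp⟩
  have hgd := hd hd0
  set a := inner ℝ (gradient f x) d with ha
  have hs : Tendsto (fun i : ℕ => ρ ^ i) atTop (𝓝 0) :=
    tendsto_pow_atTop_nhds_zero_of_lt_one hρ.le hρ1
  have hy : Tendsto (fun i : ℕ => x - ρ ^ i • d) atTop (𝓝 x) := by
    simpa using tendsto_const_nhds.sub (hs.smul_const d)
  -- This linearisation error is exactly what sufficient decrease leaves over: for step `s` it
  -- amounts to `s (1 - c) a`.
  have hε : 0 < (1 - c) * a / ‖d‖ := by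
    have := norm_pos_iff.2 hd0
    have : 0 < 1 - c := by linarith
    positivity
  have hlo := (hy.eventually ((hasFDerivAt_iff_isLittleO.1 hf.hasFDerivAt).def hε))
  obtain ⟨i, hi1, hi2⟩ := ((hy.eventually_mem hU).and hlo).exists
  refine ⟨i, hi1, ?_⟩
  have hpos : 0 < ρ ^ i := by positivity
  have h1 : x - ρ ^ i • d - x = -(ρ ^ i • d) := by abel
  rw [h1, norm_neg, norm_smul, Real.norm_of_nonneg hpos.le, map_neg, map_smul,
    ← inner_gradient_apply, ← ha, smul_eq_mul, Real.norm_eq_abs] at hi2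
  have h2 := (abs_le.1 hi2).2
  have h3 : (1 - c) * a / ‖d‖ * (ρ ^ i * ‖d‖) = ρ ^ i * ((1 - c) * a) := by
    have := (norm_pos_iff.2 hd0).ne'
    field_simp
  rw [h3] at h2
  linarith

/-- Armijo backtracking along gradient-related directions drives the gradient to zero. -/
theorem tendsto_norm_gradient_of_armijo [FiniteDimensional ℝ E] [CompleteSpace E] {f : E → ℝ}
    {U Z : Set E} (hU : IsOpen U) (hZ : IsCompact Z) (hZU : Z ⊆ U)
    (hf : ∀ x ∈ U, ContDiffAt ℝ ∞ f x) {c ρ a b : ℝ} (hc : 0 < c) (hc1 : c < 1) (hρ : 0 < ρ)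
    (hρ1 : ρ < 1) (ha : 0 < a) (hb : 0 ≤ b) {x d : ℕ → E} {i : ℕ → ℕ} (hx : ∀ k, x k ∈ Z)
    (haccept : ∀ k, f (x (k + 1)) ≤ f (x k) - c * ρ ^ i k * inner ℝ (gradient f (x k)) (d k))
    (hreject : ∀ k, ∀ j < i k, ¬ (x k - ρ ^ j • d k ∈ U ∧
      f (x k - ρ ^ j • d k) ≤ f (x k) - c * ρ ^ j * inner ℝ (gradient f (x k)) (d k)))
    (hgd : ∀ k, a * ‖gradient f (x k)‖ ^ 2 ≤ inner ℝ (gradient f (x k)) (d k))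
    (hdb : ∀ k, ‖d k‖ ≤ b * ‖gradient f (x k)‖) :
    Tendsto (fun k => ‖gradient f (x k)‖) atTop (𝓝 0) := by
  have hfc : ContinuousOn f Z := fun y hy => (hf y (hZU hy)).continuousAt.continuousWithinAt
  have hgc : ContinuousOn (gradient f) Z := fun y hy =>
    (hf y (hZU hy)).gradient.continuousAt.continuousWithinAt
  have hgd0 : ∀ k, 0 ≤ inner ℝ (gradient f (x k)) (d k) := fun k =>
    (by positivity : (0 : ℝ) ≤ a * ‖gradient f (x k)‖ ^ 2).trans (hgd k)
  obtain ⟨C, hC⟩ := hZ.exists_bound_of_continuousOn hfc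
  obtain ⟨G, hG⟩ := hZ.exists_bound_of_continuousOn hgc
  have hsum : Summable fun k => c * ρ ^ i k * inner ℝ (gradient f (x k)) (d k) := by
    refine summable_of_sum_range_le (c := f (x 0) + C)
      (fun k => mul_nonneg (by positivity) (hgd0 k)) fun N => ?_
    have h1 : ∑ k ∈ Finset.range N, c * ρ ^ i k * inner ℝ (gradient f (x k)) (d k) ≤
        f (x 0) - f (x N) := by
      rw [← Finset.sum_range_sub' (fun k => f (x k))]
      exact Finset.sum_le_sum fun k _ => by linarith [haccept k]
    have h2 := neg_le_of_abs_le (hC (x N) (hx N))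
    linarith
  have hzero := hsum.tendsto_atTop_zero
  -- Along an ultrafilter the points, directions and step sizes all converge by compactness, with no
  -- subsequences to extract.
  rw [tendsto_iff_ultrafilter]
  intro V hV
  obtain ⟨y, hyZ, hy⟩ := hZ.ultrafilter_le_nhds' (V.map x)
    (Ultrafilter.mem_map.2 (Eventually.of_forall hx))
  have hxy : Tendsto x V (𝓝 y) := hy
  obtain ⟨e, -, he⟩ := (isCompact_closedBall (0 : E) (b * G)).ultrafilter_le_nhds' (V.map d)
    (Ultrafilter.mem_map.2 (Eventually.of_forall fun k => by
      rw [mem_closedBall_zero_iff]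
      exact (hdb k).trans (mul_le_mul_of_nonneg_left (hG _ (hx k)) hb)))
  have hde : Tendsto d V (𝓝 e) := he
  obtain ⟨s, -, hs⟩ := (isCompact_Icc (a := (0 : ℝ)) (b := 1)).ultrafilter_le_nhds'
    (V.map fun k => ρ ^ i k) (Ultrafilter.mem_map.2 (Eventually.of_forall fun k =>
      ⟨by positivity, pow_le_one₀ hρ.le hρ1.le⟩))
  have hss : Tendsto (fun k => ρ ^ i k) V (𝓝 s) := hs
  have hg : Tendsto (fun k => gradient f (x k)) V (𝓝 (gradient f y)) :=
    (hf y (hZU hyZ)).gradient.continuousAt.tendsto.comp hxy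
  have hin : Tendsto (fun k => inner ℝ (gradient f (x k)) (d k)) V
      (𝓝 (inner ℝ (gradient f y) e)) := hg.inner hde
  have hprod : c * s * inner ℝ (gradient f y) e = 0 :=
    tendsto_nhds_unique ((hss.const_mul c).mul hin) (hzero.mono_left hV)
  have hlim : a * ‖gradient f y‖ ^ 2 ≤ inner ℝ (gradient f y) e :=
    le_of_tendsto_of_tendsto' ((hg.norm.pow 2).const_mul a) hin hgd
  suffices h0 : inner ℝ (gradient f y) e ≤ 0 by
    have h1 : ‖gradient f y‖ = 0 := by
      have : ‖gradient f y‖ ^ 2 ≤ 0 := by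
        by_contra! h2
        nlinarith [mul_pos ha h2]
      exact pow_eq_zero_iff two_ne_zero |>.1 (le_antisymm this (sq_nonneg _))
    rw [← h1]
    exact hg.norm
  by_contra! hpos
  have hs0 : s = 0 := by
    rcases mul_eq_zero.1 hprod with h | h
    · exact (mul_eq_zero.1 h).resolve_left hc.ne'
    · exact absurd h hpos.ne'
  subst hs0
  -- A positive limiting slope forces the steps to zero, so backtracking has occurred and the
  -- exponent `i k - 1` was rejected.
  have hi1 : ∀ᶠ k in (V : Filter ℕ), 1 ≤ i k := by
    filter_upwards [hss.eventually_lt_const one_pos] with k hk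
    rcases Nat.eq_zero_or_pos (i k) with h | h
    · rw [h, pow_zero] at hk; exact absurd hk (lt_irrefl _)
    · exact h
  have hs' : Tendsto (fun k => ρ ^ (i k - 1)) V (𝓝 0) := by
    have h1 := hss.div_const ρ
    rw [zero_div] at h1
    refine h1.congr' ?_
    filter_upwards [hi1] with k hk
    rw [div_eq_iff hρ.ne', ← pow_succ, Nat.sub_add_cancel hk]
  have hz : Tendsto (fun k => x k - ρ ^ (i k - 1) • d k) V (𝓝 y) := by
    simpa using hxy.sub (hs'.smul hde)
  -- Both the base point and the rejected trial point move towards `y`, hence the strict derivative.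
  have hstrict := ((hf y (hZU hyZ)).hasStrictFDerivAt (by simp))
  have hkey : ∀ ε > 0, inner ℝ (gradient f y) e - ε * ‖e‖ ≤ c * inner ℝ (gradient f y) e := by
    intro ε hε
    have hlo := (hz.prodMk_nhds hxy).eventually ((hasStrictFDerivAt_iff_isLittleO.1 hstrict).def hε)
    have hlim1 : Tendsto (fun k => inner ℝ (gradient f y) (d k) - ε * ‖d k‖) V
        (𝓝 (inner ℝ (gradient f y) e - ε * ‖e‖)) :=
      (tendsto_const_nhds.inner hde).sub (hde.norm.const_mul ε)
    refine le_of_tendsto_of_tendsto hlim1 (hin.const_mul c) ?_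
    filter_upwards [hlo, hi1, hz.eventually_mem (hU.mem_nhds (hZU hyZ))] with k hk1 hk2 hk3
    have hrej := hreject k (i k - 1) (by omega)
    -- The rejected point lies in `U`, so it must have failed the decrease inequality.
    have hnle : ¬ _ := fun h => hrej ⟨hk3, h⟩
    rw [not_le] at hnle
    set σ := ρ ^ (i k - 1) with hσ
    have hσ0 : 0 < σ := by positivity
    have h1 : x k - σ • d k - x k = -(σ • d k) := by abel
    simp only [h1, norm_neg, norm_smul, Real.norm_of_nonneg hσ0.le, map_neg, map_smul,
      ← inner_gradient_apply, smul_eq_mul] at hk1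
    have h2 := (abs_le.1 hk1).2
    have h3 : σ * (inner ℝ (gradient f y) (d k) - ε * ‖d k‖) ≤
        σ * (c * inner ℝ (gradient f (x k)) (d k)) := by linarith
    exact le_of_mul_le_mul_left h3 hσ0
  have hfin : inner ℝ (gradient f y) e ≤ c * inner ℝ (gradient f y) e := by
    by_contra! h
    rcases (norm_nonneg e).eq_or_lt with h0 | h0
    · have := hkey 1 one_pos
      rw [← h0] at this; linarith
    · have := hkey ((inner ℝ (gradient f y) e - c * inner ℝ (gradient f y) e) / (2 * ‖e‖))
        (div_pos (by linarith) (by linarith))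
      rw [div_mul_eq_mul_div, mul_div_mul_right _ _ h0.ne'] at this
      linarith
  nlinarith

end Armijo

/-! ### Newton steps, inner loops and existence of runs. -/

namespace LTISystem

variable {n m r : ℕ} {S : LTISystem n m r} {P : SIPMParams} {t : ℝ}

theorem newton_direction_bounds (hP : P.Valid) {K : Matrix (Fin m) (Fin n) ℝ}
    {H : Matrix (Fin n × Fin m) (Fin n × Fin m) ℝ}
    (hH : IsEigenvalueFloor P.δ (S.hessJLBF K t) H) {M : ℝ}
    (hM : ‖fderiv ℝ (gradient fun x => S.JLBF (matGain x) t) (vecGain K)‖ ≤ M) :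
    (max M P.δ)⁻¹ * ‖S.gradJLBF K t‖ ^ 2 ≤
        inner ℝ (S.gradJLBF K t) (WithLp.toLp 2 (H⁻¹ *ᵥ (S.gradJLBF K t).ofLp)) ∧
      ‖(WithLp.toLp 2 (H⁻¹ *ᵥ (S.gradJLBF K t).ofLp) : GainVec n m)‖ ≤
        P.δ⁻¹ * ‖S.gradJLBF K t‖ := by
  refine hH.direction_bounds hP.2.1 (fun v => (hessianMatrix_quadratic_le _ _ v).trans ?_) _
  refine mul_le_mul_of_nonneg_right hM ?_
  exact Finset.sum_nonneg fun i _ => mul_self_nonneg _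

theorem newton_direction_pos (hP : P.Valid) {K : Matrix (Fin m) (Fin n) ℝ}
    {H : Matrix (Fin n × Fin m) (Fin n × Fin m) ℝ}
    (hH : IsEigenvalueFloor P.δ (S.hessJLBF K t) H) {d : GainVec n m}
    (hd : d = WithLp.toLp 2 (H⁻¹ *ᵥ (S.gradJLBF K t).ofLp)) (hg : S.gradJLBF K t ≠ 0) :
    0 < inner ℝ (S.gradJLBF K t) d := by
  rw [hd]
  refine lt_of_lt_of_le ?_ (newton_direction_bounds hP hH le_rfl).1
  have h1 := norm_pos_iff.2 hg
  have h2 := lt_max_of_lt_right (b := ‖fderiv ℝ (gradient fun x => S.JLBF (matGain x) t)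
    (vecGain K)‖) hP.2.1
  positivity

theorem newton_direction_nonneg (hP : P.Valid) {K : Matrix (Fin m) (Fin n) ℝ}
    {H : Matrix (Fin n × Fin m) (Fin n × Fin m) ℝ}
    (hH : IsEigenvalueFloor P.δ (S.hessJLBF K t) H) {d : GainVec n m}
    (hd : d = WithLp.toLp 2 (H⁻¹ *ᵥ (S.gradJLBF K t).ofLp)) :
    0 ≤ inner ℝ (S.gradJLBF K t) d := by
  by_cases hg : S.gradJLBF K t = 0
  · simp [hg]
  · exact (newton_direction_pos hP hH hd hg).le

theorem isOpen_strictlyFeasible_vec (S : LTISystem n m r) :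
    IsOpen {x : GainVec n m | S.StrictlyFeasible (matGain x)} :=
  S.isOpen_strictlyFeasible.preimage continuous_matGain

theorem StrictlyFeasible.exists_newtonStep (hP : P.Valid) {K : Matrix (Fin m) (Fin n) ℝ}
    (hK : S.StrictlyFeasible K) : ∃ K', S.NewtonStep P t K K' := by
  classical
  have hcd := hK.contDiffAt_JLBF t
  obtain ⟨H, hH⟩ := exists_isEigenvalueFloor P.δ (hessianMatrix_isHermitian hcd)
  set d : GainVec n m := WithLp.toLp 2 (H⁻¹ *ᵥ (S.gradJLBF K t).ofLp) with hd
  have hex : ∃ i : ℕ, S.ArmijoAccepts P t K d (P.ρ ^ i) := by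
    have := exists_armijo_step (d := d) (c := P.c) (hcd.differentiableAt (by simp))
      (S.isOpen_strictlyFeasible_vec.mem_nhds (by simpa [matGain_vecGain] using hK))
      hP.2.2.2.1.2 hP.2.2.2.2.1 hP.2.2.2.2.2 (fun hd0 => newton_direction_pos hP hH hd fun hg => by
        apply hd0; rw [hd, hg]; ext i; simp)
    obtain ⟨i, hi1, hi2⟩ := this
    exact ⟨i, hi1, hi2⟩
  exact ⟨_, H, d, Nat.find hex, hH, hd, Nat.find_spec hex, fun j hj => Nat.find_min hex hj, rfl⟩

theorem NewtonStep.strictlyFeasible {K K' : Matrix (Fin m) (Fin n) ℝ}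
    (h : S.NewtonStep P t K K') : S.StrictlyFeasible K' := by
  obtain ⟨H, d, i, -, -, h1, -, rfl⟩ := h
  exact h1.1

theorem NewtonStep.JLBF_le (hP : P.Valid) {K K' : Matrix (Fin m) (Fin n) ℝ}
    (h : S.NewtonStep P t K K') : S.JLBF K' t ≤ S.JLBF K t := by
  obtain ⟨H, d, i, hH, hd, h1, -, rfl⟩ := h
  refine h1.2.trans (sub_le_self _ (mul_nonneg (mul_nonneg hP.2.2.2.1.1.le ?_)
    (newton_direction_nonneg hP hH hd)))
  exact pow_nonneg hP.2.2.2.2.1.le _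

theorem NewtonStep.gradJLBF_eq_zero (hP : P.Valid) {K : Matrix (Fin m) (Fin n) ℝ}
    (h : S.NewtonStep P t K K) : S.gradJLBF K t = 0 := by
  obtain ⟨H, d, i, hH, hd, h1, -, h2⟩ := h
  by_contra hg
  have hpos := newton_direction_pos hP hH hd hg
  have h3 : matGain d = 0 := by
    have h4 := sub_eq_self.1 h2.symm
    exact (smul_eq_zero.1 h4).resolve_left (pow_pos hP.2.2.2.2.1 _).ne'
  have h5 : d = 0 := by rw [← vecGain_matGain d, h3]; rfl
  rw [h5, inner_zero_right] at hpos
  exact lt_irrefl _ hpos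

theorem tendsto_gradJLBF_of_newtonStep (hDC : S.Dᵀ * S.C = 0) (hDD : (S.Dᵀ * S.D).PosDef)
    (hGG : (S.G * S.Gᵀ).PosDef) (hP : P.Valid) (ht : 0 < t)
    {k : ℕ → Matrix (Fin m) (Fin n) ℝ} (h0 : S.StrictlyFeasible (k 0))
    (hk : ∀ i, S.NewtonStep P t (k i) (k (i + 1))) :
    Tendsto (fun i => ‖S.gradJLBF (k i) t‖) atTop (𝓝 0) := by
  have hanti : Antitone fun i => S.JLBF (k i) t := antitone_nat_of_succ_le fun i => (hk i).JLBF_le hP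
  have hSF : ∀ i, S.StrictlyFeasible (k i) := fun i => by
    cases i with
    | zero => exact h0
    | succ i => exact (hk i).strictlyFeasible
  obtain ⟨Z, hZ, hZU, hZmem⟩ := exists_isCompact_JLBF_sublevel hDC hDD hGG ht (S.JLBF (k 0) t)
  have hZ' : IsCompact (vecGain '' Z) := hZ.image continuous_vecGain
  have hZU' : vecGain '' Z ⊆ {x : GainVec n m | S.StrictlyFeasible (matGain x)} := by
    rintro _ ⟨K, hK, rfl⟩
    simpa [matGain_vecGain] using hZU hK
  have hcd : ∀ x ∈ {x : GainVec n m | S.StrictlyFeasible (matGain x)},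
      ContDiffAt ℝ ∞ (fun x => S.JLBF (matGain x) t) x := by
    intro x hx
    have := StrictlyFeasible.contDiffAt_JLBF hx t
    rwa [vecGain_matGain] at this
  -- A uniform Hessian bound on the compact sublevel set makes the lower slope constant independent
  -- of the iterate.
  obtain ⟨M, hM⟩ := hZ'.exists_bound_of_continuousOn
    (f := fderiv ℝ (gradient fun x => S.JLBF (matGain x) t)) fun x hx =>
      (((hcd x (hZU' hx)).gradient.fderiv_right (m := ∞)
        (by simp)).continuousAt).continuousWithinAt
  choose H d i hH hd hacc hrej hstep using hk
  have hmem : ∀ j, vecGain (k j) ∈ vecGain '' Z := fun j =>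
    Set.mem_image_of_mem _ (hZmem _ (hSF j) (hanti (Nat.zero_le j)))
  have hbd := fun j => newton_direction_bounds hP (hH j) (hM _ (hmem j))
  refine tendsto_norm_gradient_of_armijo (f := fun x => S.JLBF (matGain x) t)
    S.isOpen_strictlyFeasible_vec hZ' hZU' hcd
    (c := P.c) (ρ := P.ρ) (a := (max M P.δ)⁻¹) (b := P.δ⁻¹) (x := fun j => vecGain (k j))
    (d := d) (i := i) hP.2.2.2.1.1 hP.2.2.2.1.2 hP.2.2.2.2.1 hP.2.2.2.2.2
    (inv_pos.2 (lt_max_of_lt_right hP.2.1)) (inv_pos.2 hP.2.1).le hmem (fun j => ?_)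
    (fun j l hl h => hrej j l hl ⟨h.1, h.2⟩) (fun j => ?_) (fun j => ?_)
  · have := (hacc j).2
    rw [← hstep j] at this
    exact this
  · rw [hd j]; exact (hbd j).1
  · rw [hd j]; exact (hbd j).2

/-- Both stopping tests give a small gradient: an unchanged iterate means a zero direction, hence a
zero gradient. -/
theorem InnerLoop.result (hP : P.Valid) {ε : ℝ} (hε : 0 < ε) {K K' : Matrix (Fin m) (Fin n) ℝ}
    (h : S.InnerLoop P t ε K K') :
    S.StrictlyFeasible K' ∧ S.JLBF K' t ≤ S.JLBF K t ∧ ‖S.gradJLBF K' t‖ < ε := by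
  obtain ⟨N, k, rfl, rfl, hstep, hend, -⟩ := h
  have hle : ∀ i ≤ N + 1, S.JLBF (k i) t ≤ S.JLBF (k 0) t := by
    intro i hi
    induction i with
    | zero => exact le_rfl
    | succ i ih => exact ((hstep i (by omega)).JLBF_le hP).trans (ih (by omega))
  refine ⟨(hstep N le_rfl).strictlyFeasible, hle _ le_rfl, ?_⟩
  rcases hend with h | h
  · exact h
  · have h1 := hstep N le_rfl
    rw [h] at h1 ⊢
    rw [h1.gradJLBF_eq_zero hP, norm_zero]
    exact hε

theorem StrictlyFeasible.exists_innerLoop (hDC : S.Dᵀ * S.C = 0) (hDD : (S.Dᵀ * S.D).PosDef)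
    (hGG : (S.G * S.Gᵀ).PosDef) (hP : P.Valid) (ht : 0 < t) {ε : ℝ} (hε : 0 < ε)
    {K : Matrix (Fin m) (Fin n) ℝ} (hK : S.StrictlyFeasible K) :
    ∃ K', S.InnerLoop P t ε K K' := by
  classical
  choose! F hF using fun (K : Matrix (Fin m) (Fin n) ℝ) (h : S.StrictlyFeasible K) =>
    h.exists_newtonStep (t := t) hP
  let k : ℕ → Matrix (Fin m) (Fin n) ℝ := fun i => F^[i] K
  have hsucc : ∀ i, k (i + 1) = F (k i) := fun i => Function.iterate_succ_apply' F i K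
  have hSF : ∀ i, S.StrictlyFeasible (k i) := fun i => by
    induction i with
    | zero => exact hK
    | succ i ih => rw [hsucc]; exact (hF _ ih).strictlyFeasible
  have hstep : ∀ i, S.NewtonStep P t (k i) (k (i + 1)) := fun i => by
    rw [hsucc]; exact hF _ (hSF i)
  have hlim := tendsto_gradJLBF_of_newtonStep hDC hDD hGG hP ht hK hstep
  have hex : ∃ N, S.InnerStop t ε (k N) (k (N + 1)) := by
    obtain ⟨N, hN⟩ := (((tendsto_add_atTop_iff_nat 1).2 hlim).eventually_lt_const hε).exists
    exact ⟨N, Or.inl hN⟩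
  exact ⟨k (Nat.find hex + 1), Nat.find hex, k, rfl, rfl, fun i _ => hstep i, Nat.find_spec hex,
    fun i hi => Nat.find_min hex hi⟩

theorem penalty_pos (hP : P.Valid) (h : ℕ) : 0 < P.μ ^ h * P.t₀ :=
  mul_pos (pow_pos (one_pos.trans hP.1) h) hP.2.2.1

theorem exists_isSIPMRun (hDC : S.Dᵀ * S.C = 0) (hDD : (S.Dᵀ * S.D).PosDef)
    (hGG : (S.G * S.Gᵀ).PosDef) (hP : P.Valid) {K₀ : Matrix (Fin m) (Fin n) ℝ}
    (hK₀ : S.StrictlyFeasible K₀) {ε : ℕ → ℝ} (hε : ∀ h, 0 < ε h) :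
    ∃ K, S.IsSIPMRun P ε K₀ K := by
  choose! F hF using fun (h : ℕ) (K : Matrix (Fin m) (Fin n) ℝ) (hK : S.StrictlyFeasible K) =>
    hK.exists_innerLoop hDC hDD hGG hP (penalty_pos hP h) (hε h)
  let K : ℕ → Matrix (Fin m) (Fin n) ℝ := fun h => Nat.rec K₀ (fun h X => F h X) h
  have hSF : ∀ h, S.StrictlyFeasible (K h) := fun h => by
    induction h with
    | zero => exact hK₀
    | succ h ih => exact ((hF h _ ih).result hP (hε h)).1
  exact ⟨K, rfl, fun h => hF h _ (hSF h)⟩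

theorem StrictlyFeasible.JLBF_antitone {K : Matrix (Fin m) (Fin n) ℝ}
    (hK : S.StrictlyFeasible K) {t' : ℝ} (ht : 0 < t) (htt' : t ≤ t') :
    S.JLBF K t' ≤ S.JLBF K t := by
  have h1 := mul_le_mul_of_nonpos_right (one_div_le_one_div_of_le ht htt') hK.sum_log_slack_nonpos
  rw [JLBF, JLBF]
  linarith

/-! ### Outer iterates: multipliers, costs and accumulation points. -/

section Run

variable {K₀ : Matrix (Fin m) (Fin n) ℝ} {ε : ℕ → ℝ} {K : ℕ → Matrix (Fin m) (Fin n) ℝ}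

theorem IsSIPMRun.strictlyFeasible (hP : P.Valid) (hK₀ : S.StrictlyFeasible K₀)
    (hε : ∀ h, 0 < ε h) (hrun : S.IsSIPMRun P ε K₀ K) (h : ℕ) : S.StrictlyFeasible (K h) := by
  cases h with
  | zero => rw [hrun.1]; exact hK₀
  | succ h => exact ((hrun.2 h).result hP (hε h)).1

theorem IsSIPMRun.antitone (hP : P.Valid)
    (hε : ∀ h, 0 < ε h) (hrun : S.IsSIPMRun P ε K₀ K) :
    Antitone fun h => S.JLBF (K h) (P.μ ^ h * P.t₀) := by
  refine antitone_nat_of_succ_le fun h => ?_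
  have hres := (hrun.2 h).result hP (hε h)
  refine (hres.1.JLBF_antitone (penalty_pos hP h) ?_).trans hres.2.1
  exact mul_le_mul_of_nonneg_right (pow_le_pow_right₀ hP.1.le (Nat.le_succ h)) hP.2.2.1.le

theorem IsSIPMRun.mem_energySublevel (hP : P.Valid) (hK₀ : S.StrictlyFeasible K₀)
    (hε : ∀ h, 0 < ε h) (hrun : S.IsSIPMRun P ε K₀ K) (h : ℕ) :
    K h ∈ S.energySublevel (S.JLBF K₀ P.t₀) := by
  have hSF := hrun.strictlyFeasible hP hK₀ hε h
  refine LTISystem.mem_energySublevel hSF.mem_stabGains ?_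
  refine (hSF.J_le_JLBF (penalty_pos hP h)).trans ?_
  have := hrun.antitone hP hε (Nat.zero_le h)
  simpa [hrun.1] using this

theorem tendsto_penalty (hP : P.Valid) : Tendsto (fun h : ℕ => P.μ ^ h * P.t₀) atTop atTop :=
  (tendsto_pow_atTop_atTop_of_one_lt hP.1).atTop_mul_const hP.2.2.1

theorem continuousAt_gradJ {K : Matrix (Fin m) (Fin n) ℝ} (hK : K ∈ S.stabGains) :
    ContinuousAt S.gradJ K :=
  ContinuousAt.comp (g := gradient fun x => S.J (matGain x)) (f := vecGain)
    (contDiffAt_J hK).gradient.continuousAt continuous_vecGain.continuousAt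

theorem continuousAt_J {K : Matrix (Fin m) (Fin n) ℝ} (hK : K ∈ S.stabGains) :
    ContinuousAt S.J K :=
  ContinuousAt.comp (g := fun x => S.J (matGain x)) (f := vecGain)
    (contDiffAt_J hK).continuousAt continuous_vecGain.continuousAt

theorem StrictlyFeasible.barrierDual_nonneg {K : Matrix (Fin m) (Fin n) ℝ}
    (hK : S.StrictlyFeasible K) (ht : 0 < t) (i : Fin n ⊕ Unit) (j : Fin n) :
    0 ≤ S.barrierDual K t i j := one_div_nonneg.2 (mul_nonneg ht.le (hK i j).le)

theorem StrictlyFeasible.barrierDual_mul_slack {K : Matrix (Fin m) (Fin n) ℝ}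
    (hK : S.StrictlyFeasible K) (ht : 0 < t) (i : Fin n ⊕ Unit) (j : Fin n) :
    S.barrierDual K t i j * S.slack K i j = 1 / t := by
  have := (hK i j).ne'
  have := ht.ne'
  rw [barrierDual, Matrix.of_apply]
  field_simp

/-- Moving towards a strictly feasible gain bounds the barrier multipliers. -/
theorem StrictlyFeasible.barrierDual_le {K : Matrix (Fin m) (Fin n) ℝ}
    (hK : S.StrictlyFeasible K) (hK₀ : S.StrictlyFeasible K₀) (ht : 0 < t) (i : Fin n ⊕ Unit)
    (j : Fin n) : S.barrierDual K t i j * S.slack K₀ i j ≤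
      (‖S.gradJ K‖ + ‖S.gradJLBF K t‖) * ‖vecGain K₀ - vecGain K‖ +
        ∑ _i : Fin n ⊕ Unit, ∑ _j : Fin n, 1 / t := by
  have h1 := hK.gradJLBF_eq t
  have h2 := S.inner_vecGain_dualTerm (S.barrierDual K t) (vecGain K₀ - vecGain K)
  have h3 : S.slackDir (matGain (vecGain K₀ - vecGain K)) = S.slack K₀ - S.slack K := by
    have : matGain (vecGain K₀ - vecGain K) = K₀ - K := rfl
    rw [this, eq_sub_iff_add_eq', ← slack_add, add_sub_cancel]
  have h4 : vecGain (S.dualTerm (S.barrierDual K t)) = S.gradJ K - S.gradJLBF K t := by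
    rw [h1]; abel
  -- Affinity gives `S(K₀) = S(K) + slackDir (K₀ - K)`; the first part contributes `1 / t` per
  -- entry.
  have h5 : ∑ i, ∑ j, S.barrierDual K t i j * S.slack K₀ i j =
      inner ℝ (S.gradJ K - S.gradJLBF K t) (vecGain K₀ - vecGain K) +
        ∑ _i : Fin n ⊕ Unit, ∑ _j : Fin n, 1 / t := by
    rw [← h4, h2, h3, ← Finset.sum_add_distrib]
    refine Finset.sum_congr rfl fun i _ => ?_
    rw [← Finset.sum_add_distrib]
    refine Finset.sum_congr rfl fun j _ => ?_
    rw [← hK.barrierDual_mul_slack ht i j, Matrix.sub_apply]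
    ring
  have hnn : ∀ i j, 0 ≤ S.barrierDual K t i j * S.slack K₀ i j := fun i j =>
    mul_nonneg (hK.barrierDual_nonneg ht i j) (hK₀ i j).le
  calc S.barrierDual K t i j * S.slack K₀ i j
      ≤ ∑ j, S.barrierDual K t i j * S.slack K₀ i j :=
        Finset.single_le_sum (f := fun j => S.barrierDual K t i j * S.slack K₀ i j)
          (fun j _ => hnn i j) (Finset.mem_univ j)
    _ ≤ ∑ i, ∑ j, S.barrierDual K t i j * S.slack K₀ i j :=
        Finset.single_le_sum (f := fun i => ∑ j, S.barrierDual K t i j * S.slack K₀ i j)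
          (fun i _ => Finset.sum_nonneg fun j _ => hnn i j) (Finset.mem_univ i)
    _ ≤ _ := by
        rw [h5]
        gcongr
        refine (real_inner_le_norm _ _).trans ?_
        gcongr
        exact norm_sub_le _ _

/-- Gains range over a compact set of stabilising gains and tolerances are bounded, so the estimate
towards `K₀` is uniform. The index shift reflects that `K (h + 1)` is computed with penalty `t⁽ʰ⁾`.
-/
theorem IsSIPMRun.exists_dual_bound (hDC : S.Dᵀ * S.C = 0) (hDD : (S.Dᵀ * S.D).PosDef)
    (hGG : (S.G * S.Gᵀ).PosDef) (hdet : S.Detectable) (hP : P.Valid)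
    (hK₀ : S.StrictlyFeasible K₀) (hε : ∀ h, 0 < ε h) {η : ℝ} (hη : Tendsto ε atTop (𝓝 η))
    (hrun : S.IsSIPMRun P ε K₀ K) :
    ∃ b : ℝ, 0 < b ∧ ∀ h i j,
      S.barrierDual (K (h + 1)) (P.μ ^ h * P.t₀) i j ≤ b / S.slack K₀ i j := by
  have hZ := isCompact_energySublevel hDC hDD hGG (S.JLBF K₀ P.t₀)
  have hZF := energySublevel_subset_stabGains hDC hDD hGG hdet (S.JLBF K₀ P.t₀)
  obtain ⟨G, hG⟩ := hZ.exists_bound_of_continuousOn (f := S.gradJ) fun K hK =>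
    (continuousAt_gradJ (hZF hK)).continuousWithinAt
  obtain ⟨R, hR⟩ := hZ.exists_bound_of_continuousOn (f := fun K => vecGain K₀ - vecGain K)
    (continuous_const.sub continuous_vecGain).continuousOn
  obtain ⟨e, he⟩ := hη.bddAbove_range
  set b := (G + e) * R + ∑ _i : Fin n ⊕ Unit, ∑ _j : Fin n, 1 / P.t₀ with hb
  have hmain : ∀ h i j, S.barrierDual (K (h + 1)) (P.μ ^ h * P.t₀) i j * S.slack K₀ i j ≤ b := by
    intro h i j
    have hSF := hrun.strictlyFeasible hP hK₀ hε (h + 1)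
    have hmem := hrun.mem_energySublevel hP hK₀ hε (h + 1)
    refine (hSF.barrierDual_le hK₀ (penalty_pos hP h) i j).trans ?_
    have h1 := hG _ hmem
    have h2 := hR _ hmem
    have h3 := ((hrun.2 h).result hP (hε h)).2.2
    have h4 : ε h ≤ e := he ⟨h, rfl⟩
    refine add_le_add (mul_le_mul (by linarith) h2 (norm_nonneg _) ?_) ?_
    · linarith [norm_nonneg (S.gradJ (K (h + 1))), hε h]
    · refine Finset.sum_le_sum fun i _ => Finset.sum_le_sum fun j _ =>
        one_div_le_one_div_of_le hP.2.2.1 ?_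
      exact le_mul_of_one_le_left hP.2.2.1.le (one_le_pow₀ hP.1.le)
  -- Positivity of the bound is needed later for its logarithm.
  refine ⟨max b 1, lt_max_of_lt_right one_pos, fun h i j => ?_⟩
  rw [le_div_iff₀ (hK₀ i j)]
  exact (hmain h i j).trans (le_max_left _ _)

theorem tendsto_log_mul_div {b : ℝ} (hb : 0 < b) :
    Tendsto (fun t : ℝ => (1 / t) * Real.log (t * b)) atTop (𝓝 0) := by
  have h1 : Tendsto (fun t : ℝ => Real.log t / t) atTop (𝓝 0) :=
    Real.isLittleO_log_id_atTop.tendsto_div_nhds_zero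
  have h2 : Tendsto (fun t : ℝ => Real.log b / t) atTop (𝓝 0) :=
    tendsto_const_nhds.div_atTop tendsto_id
  have h3 := h1.add h2
  rw [add_zero] at h3
  refine h3.congr' ?_
  filter_upwards [eventually_gt_atTop 0] with t ht
  rw [Real.log_mul ht.ne' hb.ne']
  ring

theorem IsSIPMRun.exists_tendsto_J (hDC : S.Dᵀ * S.C = 0) (hDD : (S.Dᵀ * S.D).PosDef)
    (hGG : (S.G * S.Gᵀ).PosDef) (hdet : S.Detectable) (hP : P.Valid)
    (hK₀ : S.StrictlyFeasible K₀) (hε : ∀ h, 0 < ε h) {η : ℝ} (hη : Tendsto ε atTop (𝓝 η))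
    (hrun : S.IsSIPMRun P ε K₀ K) : ∃ l, Tendsto (fun h => S.J (K h)) atTop (𝓝 l) := by
  obtain ⟨b, hb, hQ⟩ := hrun.exists_dual_bound hDC hDD hGG hdet hP hK₀ hε hη
  have hSF := hrun.strictlyFeasible hP hK₀ hε
  have hbdd : BddBelow (Set.range fun h => S.JLBF (K h) (P.μ ^ h * P.t₀)) :=
    ⟨0, by
      rintro _ ⟨h, rfl⟩
      exact (J_nonneg _).trans ((hSF h).J_le_JLBF (penalty_pos hP h))⟩
  have hlim := tendsto_atTop_ciInf (hrun.antitone hP hε) hbdd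
  -- The multiplier bound says that the inverse slack is at most `t⁽ʰ⁾` times a constant, so each
  -- term is at most of order `log t / t`.
  have hbar : Tendsto (fun h => (1 / (P.μ ^ (h + 1) * P.t₀)) *
      ∑ i, ∑ j, Real.log (S.slack (K (h + 1)) i j)) atTop (𝓝 0) := by
    simp_rw [Finset.mul_sum]
    rw [show (0 : ℝ) = ∑ _i : Fin n ⊕ Unit, ∑ _j : Fin n, 0 by simp]
    refine tendsto_finsetSum _ fun i _ => tendsto_finsetSum _ fun j _ => ?_
    have hb0 : 0 < b / S.slack K₀ i j := div_pos hb (hK₀ i j)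
    refine squeeze_zero_norm (fun h => ?_) ((tendsto_log_mul_div hb0).comp (tendsto_penalty hP))
    have ht := penalty_pos hP h
    have ht1 := penalty_pos hP (h + 1)
    have hlog := (hSF (h + 1)).log_slack_nonpos i j
    rw [Real.norm_eq_abs, abs_mul, abs_of_pos (one_div_pos.2 ht1), abs_of_nonpos hlog,
      Function.comp_apply]
    have hs := hSF (h + 1) i j
    refine mul_le_mul (one_div_le_one_div_of_le ht ?_) ?_ (neg_nonneg.2 hlog)
      (one_div_pos.2 ht).le
    · exact mul_le_mul_of_nonneg_right (pow_le_pow_right₀ hP.1.le (Nat.le_succ h)) hP.2.2.1.le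
    · rw [← Real.log_inv]
      refine Real.log_le_log (inv_pos.2 hs) ?_
      have h1 := mul_le_mul_of_nonneg_left (hQ h i j) ht.le
      refine le_trans (le_of_eq ?_) h1
      rw [barrierDual, Matrix.of_apply, one_div, mul_inv, mul_inv_cancel_left₀ ht.ne']
  refine ⟨⨅ h, S.JLBF (K h) (P.μ ^ h * P.t₀), (tendsto_add_atTop_iff_nat 1).1 ?_⟩
  have hsum := ((tendsto_add_atTop_iff_nat 1).2 hlim).add hbar
  rw [add_zero] at hsum
  refine hsum.congr fun h => ?_
  rw [JLBF]; ring

theorem IsSIPMRun.isApproxStationary_of_mapClusterPt (hDC : S.Dᵀ * S.C = 0)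
    (hDD : (S.Dᵀ * S.D).PosDef)
    (hGG : (S.G * S.Gᵀ).PosDef) (hdet : S.Detectable) (hP : P.Valid)
    (hK₀ : S.StrictlyFeasible K₀) (hε : ∀ h, 0 < ε h) {η : ℝ} (hη : Tendsto ε atTop (𝓝 η))
    (hrun : S.IsSIPMRun P ε K₀ K) {Ks : Matrix (Fin m) (Fin n) ℝ}
    (hKs : MapClusterPt Ks atTop K) : S.IsApproxStationary η Ks := by
  have hSF := hrun.strictlyFeasible hP hK₀ hε
  have hZ := isCompact_energySublevel hDC hDD hGG (S.JLBF K₀ P.t₀)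
  have hZF := energySublevel_subset_stabGains hDC hDD hGG hdet (S.JLBF K₀ P.t₀)
  obtain ⟨b, hb, hQ⟩ := hrun.exists_dual_bound hDC hDD hGG hdet hP hK₀ hε hη
  obtain ⟨V, hV, hVK⟩ := mapClusterPt_iff_ultrafilter.1 hKs
  have hKsF : Ks ∈ S.stabGains := hZF ((S.isClosed_energySublevel _).mem_of_tendsto hVK
    (Eventually.of_forall (hrun.mem_energySublevel hP hK₀ hε)))
  -- The gain `K h` belongs to the penalty of index `h - 1`; the initial index is negligible along
  -- `V`.
  have hpred : Tendsto (fun h : ℕ => h - 1) V atTop := (tendsto_sub_atTop_nat 1).mono_left hV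
  have hge : ∀ᶠ h in (V : Filter ℕ), h - 1 + 1 = h := by
    filter_upwards [hV (eventually_ge_atTop 1)] with h hh using Nat.sub_add_cancel hh
  let τ : ℕ → ℝ := fun h => P.μ ^ (h - 1) * P.t₀
  have hτ : ∀ h, 0 < τ h := fun h => penalty_pos hP (h - 1)
  let Q : ℕ → Matrix (Fin n ⊕ Unit) (Fin n) ℝ := fun h => S.barrierDual (K h) (τ h)
  have hbox : IsCompact {X : Matrix (Fin n ⊕ Unit) (Fin n) ℝ |
      ∀ i j, X i j ∈ Set.Icc 0 (b / S.slack K₀ i j)} := by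
    have h := isCompact_univ_pi fun i : Fin n ⊕ Unit => isCompact_univ_pi fun j : Fin n =>
      isCompact_Icc (a := 0) (b := b / S.slack K₀ i j)
    simp only [Set.pi, Set.mem_univ, true_imp_iff] at h
    exact h
  obtain ⟨Qs, hQs, hQlim⟩ := hbox.ultrafilter_le_nhds' (V.map Q) (Ultrafilter.mem_map.2 (by
    filter_upwards [hge] with h hh i j
    refine ⟨(hSF h).barrierDual_nonneg (hτ h) i j, ?_⟩
    have := hQ (h - 1) i j
    rwa [hh] at this))
  have hQt : Tendsto Q V (𝓝 Qs) := hQlim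
  refine ⟨hKsF, Qs, ?_, fun i j => (hQs i j).1, fun i j => ?_, ?_⟩
  · have hc : Continuous fun X => vecGain (S.dualTerm X) := by
      refine continuous_vecGain.comp ?_
      unfold dualTerm
      fun_prop
    have h1 : Tendsto (fun h => ‖S.gradJ (K h) - vecGain (S.dualTerm (Q h))‖) V
        (𝓝 ‖S.gradJ Ks - vecGain (S.dualTerm Qs)‖) :=
      (((continuousAt_gradJ hKsF).tendsto.comp hVK).sub ((hc.tendsto _).comp hQt)).norm
    have h2 : vecGain (matGain (S.gradJ Ks) - S.dualTerm Qs) =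
        S.gradJ Ks - vecGain (S.dualTerm Qs) := rfl
    rw [h2]
    refine le_of_tendsto_of_tendsto h1 (hη.comp hpred) ?_
    filter_upwards [hge] with h hh
    have h3 := ((hrun.2 (h - 1)).result hP (hε (h - 1))).2.2
    rw [hh, (hSF h).gradJLBF_eq] at h3
    exact h3.le
  · exact ge_of_tendsto' ((S.continuous_slack_apply i j).continuousAt.tendsto.comp hVK)
      fun h => (hSF h i j).le
  · have hcomp : ∀ i j, Qs i j * S.slack Ks i j = 0 := by
      intro i j
      have h1 : Tendsto (fun h => Q h i j) V (𝓝 (Qs i j)) :=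
        tendsto_pi_nhds.1 (tendsto_pi_nhds.1 hQt i) j
      have h2 : Tendsto (fun h => S.slack (K h) i j) V (𝓝 (S.slack Ks i j)) :=
        ((S.continuous_slack_apply i j).tendsto Ks).comp hVK
      have h3 : Tendsto (fun h => 1 / τ h) V (𝓝 0) :=
        tendsto_const_nhds.div_atTop ((tendsto_penalty hP).comp hpred)
      exact tendsto_nhds_unique (h1.mul h2)
        (h3.congr fun h => ((hSF h).barrierDual_mul_slack (hτ h) i j).symm)
    simp only [Matrix.trace, Matrix.diag_apply, Matrix.mul_apply, Matrix.transpose_apply, hcomp,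
      Finset.sum_const_zero]

theorem IsApproxStationary.isStationary {K : Matrix (Fin m) (Fin n) ℝ}
    (h : S.IsApproxStationary 0 K) : S.IsStationary K := by
  obtain ⟨hK, Q, h1, h2⟩ := h
  refine ⟨hK, Q, ?_, h2⟩
  have h3 := congrArg matGain (norm_le_zero_iff.1 h1)
  rw [matGain_vecGain] at h3
  exact h3

end Run

end LTISystem

/-! ### From accumulation points to convergence of the run. -/

theorem tendsto_infDist_of_mapClusterPt_mem {X Y : Type*} [TopologicalSpace X] [MetricSpace Y]
    {u : ℕ → X} {Z : Set X} (hZ : IsCompact Z) (hu : ∀ k, u k ∈ Z) {g : X → Y} (hg : Continuous g)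
    {s : Set X} (hs : ∀ x, MapClusterPt x atTop u → x ∈ s) :
    Tendsto (fun k => Metric.infDist (g (u k)) (g '' s)) atTop (𝓝 0) := by
  rw [tendsto_iff_ultrafilter]
  intro V hV
  obtain ⟨x, -, hx⟩ := hZ.ultrafilter_le_nhds' (V.map u)
    (Ultrafilter.mem_map.2 (Eventually.of_forall hu))
  have hux : Tendsto u V (𝓝 x) := hx
  have hxs := hs x (mapClusterPt_iff_ultrafilter.2 ⟨V, hV, hux⟩)
  have h1 : Metric.infDist (g x) (g '' s) = 0 :=
    Metric.infDist_zero_of_mem (Set.mem_image_of_mem g hxs)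
  rw [← h1]
  exact (((Metric.continuous_infDist_pt _).comp hg).tendsto x).comp hux

end

theorem mainTheorem3 {n m r : ℕ} (S : LTISystem n m r)
    (hDC : S.Dᵀ * S.C = 0) (hDD : (S.Dᵀ * S.D).PosDef)
    (hGG : (S.G * S.Gᵀ).PosDef) (hdet : S.Detectable)
    (P : SIPMParams) (hP : P.Valid)
    (K₀ : Matrix (Fin m) (Fin n) ℝ) (hK₀ : S.StrictlyFeasible K₀) :
    -- the derivatives used in the KKT conditions and in the method exist
    (∀ K ∈ S.stabGains, ContDiffAt ℝ ∞ (fun x => S.J (matGain x)) (vecGain K)) ∧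
    (∀ K, S.StrictlyFeasible K → K ∈ S.stabGains ∧
      ∀ t > 0, ContDiffAt ℝ ∞ (fun x => S.JLBF (matGain x) t) (vecGain K)) ∧
    -- every Newton step can be carried out, and stays strictly feasible
    (∀ t > 0, ∀ K, S.StrictlyFeasible K → ∃ K', S.NewtonStep P t K K') ∧
    (∀ t > 0, ∀ K K', S.NewtonStep P t K K' → S.StrictlyFeasible K') ∧
    -- inner iterations drive the gradient to zero, so that every inner loop stops
    (∀ t > 0, ∀ k : ℕ → Matrix (Fin m) (Fin n) ℝ, S.StrictlyFeasible (k 0) →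
      (∀ i, S.NewtonStep P t (k i) (k (i + 1))) →
      Tendsto (fun i => ‖S.gradJLBF (k i) t‖) atTop (𝓝 0)) ∧
    -- the method runs, whatever the inner tolerances
    (∀ ε : ℕ → ℝ, (∀ h, 0 < ε h) → ∃ K, S.IsSIPMRun P ε K₀ K) ∧
    -- convergence, for inner tolerances that tend to `η`, in particular constant ones
    (∀ (ε : ℕ → ℝ) (η : ℝ), (∀ h, 0 < ε h) → Tendsto ε atTop (𝓝 η) →
      ∀ K, S.IsSIPMRun P ε K₀ K →
        (∃ Z : Set (Matrix (Fin m) (Fin n) ℝ),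
          IsCompact Z ∧ Z ⊆ S.stabGains ∧ ∀ h, K h ∈ Z) ∧
        (∀ Ks, MapClusterPt Ks atTop K → S.IsApproxStationary η Ks) ∧
        ∃ Jlim : ℝ, Tendsto (fun h => S.J (K h)) atTop (𝓝 Jlim) ∧
          -- tolerances that tend to zero: convergence to stationary points
          (η = 0 →
            (∃ Ks, MapClusterPt Ks atTop K) ∧
            (∀ Ks, MapClusterPt Ks atTop K → S.IsStationary Ks ∧ S.J Ks = Jlim) ∧
            Tendsto (fun h => Metric.infDist (vecGain (K h))
              (vecGain '' {Ks | S.IsStationary Ks ∧ S.J Ks = Jlim})) atTop (𝓝 0) ∧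
            (∀ Ks, (∀ K', S.IsStationary K' ∧ S.J K' = Jlim → K' = Ks) →
              Tendsto K atTop (𝓝 Ks)))) := by
  refine ⟨fun K hK => LTISystem.contDiffAt_J hK,
    fun K hK => ⟨hK.mem_stabGains, fun t _ => hK.contDiffAt_JLBF t⟩,
    fun t _ K hK => hK.exists_newtonStep hP, fun t _ K K' h => h.strictlyFeasible,
    fun t ht k h0 hk => LTISystem.tendsto_gradJLBF_of_newtonStep hDC hDD hGG hP ht h0 hk,
    fun ε hε => LTISystem.exists_isSIPMRun hDC hDD hGG hP hK₀ hε, ?_⟩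
  intro ε η hε hη K hrun
  have hZ := LTISystem.isCompact_energySublevel hDC hDD hGG (S.JLBF K₀ P.t₀)
  have hZF := LTISystem.energySublevel_subset_stabGains hDC hDD hGG hdet (S.JLBF K₀ P.t₀)
  have hmem := hrun.mem_energySublevel hP hK₀ hε
  have hstat : ∀ Ks, MapClusterPt Ks atTop K → S.IsApproxStationary η Ks := fun Ks hKs =>
    hrun.isApproxStationary_of_mapClusterPt hDC hDD hGG hdet hP hK₀ hε hη hKs
  obtain ⟨l, hl⟩ := hrun.exists_tendsto_J hDC hDD hGG hdet hP hK₀ hε hη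
  refine ⟨⟨_, hZ, hZF, hmem⟩, hstat, l, hl, ?_⟩
  rintro rfl
  have hcl : ∀ Ks, MapClusterPt Ks atTop K → S.IsStationary Ks ∧ S.J Ks = l := by
    intro Ks hKs
    refine ⟨(hstat Ks hKs).isStationary, ?_⟩
    obtain ⟨V, hV, hVK⟩ := mapClusterPt_iff_ultrafilter.1 hKs
    -- `J` is continuous at the accumulation point because that point is stabilising.
    exact tendsto_nhds_unique
      ((LTISystem.continuousAt_J (hstat Ks hKs).1).tendsto.comp hVK) (hl.mono_left hV)
  refine ⟨?_, hcl, tendsto_infDist_of_mapClusterPt_mem hZ hmem LTISystem.continuous_vecGain hcl,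
    fun Ks hKs => hZ.tendsto_nhds_of_unique_mapClusterPt (Eventually.of_forall hmem)
      fun K' _ hK' => hKs K' (hcl K' hK')⟩
  obtain ⟨Ks, -, hKs⟩ := hZ.exists_mapClusterPt_of_frequently (l := atTop) (f := K)
    (Eventually.of_forall hmem).frequently
  exact ⟨Ks, hKs⟩
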